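/- **Conventions.** For a finite bipartite graph $G=(V_1,V_2,E)$ with $E\subseteq V_1\times V_2$ let $G^+=(V_1,\,2^{V_2}\setminus\{\emptyset\},\,E^+)$, where $(v,B)\in E^+$ iff $\{v\}\times B\subseteq E$. A $V_1$-saturating matching in a bipartite graph with vertex classes $V_1,W$ is an injective map $M$ from $V_1$ to $W$ with $(v,M(v))$ an edge for every $v\in V_1$. For a map $M$ from $V_1$ into finite sets its order is $\max_{v\in V_1}|M(v)|$. $\mathrm{SMN}(G^+)$ denotes the smallest order of a $V_1$-saturating matching in $G^+$. Let $X$ be a finite set, let $C$ be a family of subsets of $X$ with $|C|\ge 2$, and let $Z=X\times\{0,1\}$; write $c\models(x,b)$ iff ($b=1$ and $x\in c$) or ($b=0$ and $x\notin c$). The consistency graph is $G(C)=(C,Z,\{(c,z): c\models z\})$, and $G^+(C)=G(C)^+$. An MLE-learner $L$ for $C$ is given by priors $P(c)=1/|C|$ and reals $P(z|c)\ge 0$ with $\sum_{z\in Z}P(z|c)=1$ for all $c\in C$, and $P(z|c)=0$ whenever $c\not\models z$. For $A\subseteq Z$ with $|A|=n\le N^+(C,L):=\min_{c\in C}|\{z\in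 Z:P(z|c)>0\}|$ let $$P(A|c)=\sum_{(z_1,\dots,z_n)}\ \prod_{i=1}^{n}\frac{P(z_i|c)}{1-(P(z_1|c)+\dots+P(z_{i-1}|c))},$$ where the sum runs over all orderings of $A$; this is the probability that $n$-fold unordered sampling without replacement from $P(\cdot|c)$ yields $A$. A teacher for $L$ is a map $T:C\to 2^Z$ such that, for every $c_0\in C$, $|T(c_0)|\le N^+(C,L)$ and $c_0$ is the unique maximizer of $P(c)\cdot P(T(c_0)|c)$ over $c\in C$. $\mathrm{MLETD}(C)$ is the smallest order of a teacher for $L$, minimized over all MLE-learners $L$ for $C$. **Theorem.** 1. Given a finite bipartite graph $G=(V_1,V_2,E)$, a $V_1$-saturating matching of minimum order in $G^+$ (respectively an error message if $G^+$ has no $V_1$-saturating matching) can be computed in time polynomial in $|V_1|$ and $|V_2|$. 2. For every family $C$ of at least two subsets of a finite set $X$, with labeled examples as observations, $\mathrm{SMN}(G^+(C))=\mathrm{MLETD}(C)$. Moreover, given such a family $C$, the following objects can be computed in time polynomial in $|C|$ and $|X|$: - the consistency graph $G(C)$; - the (identical) parameters $\mathrm{SMN}(G^+(C))$ and $\mathrm{MLETD}(C)$;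 - a $C$-saturating matching in $G^+(C)$ of order $\mathrm{SMN}(G^+(C))$; - (rational) parameters representing an MLE-learner $L$ for $C$, together with a teacher $T$ for $L$ of order $\mathrm{MLETD}(C)$. -/

import Mathlib

namespace MLETeaching

/-! ### Bipartite graphs, saturating matchings and their order -/

/-- A bipartite graph with vertex classes `V₁`, `V₂`, given by its edge set
`{(v, w) | G v w} ⊆ V₁ × V₂`. -/
abbrev BipGraph (V₁ V₂ : Type*) := V₁ → V₂ → Prop

/-- The graph `G⁺`: its second vertex class consists of the nonempty subsets `B` of (the finite
set) `V₂`, and `(v, B)` is an edge iff `{v} × B ⊆ E`. -/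
def BipGraph.plus {V₁ V₂ : Type*} (G : BipGraph V₁ V₂) :
    BipGraph V₁ {B : Finset V₂ // B.Nonempty} :=
  fun v B => ∀ w ∈ B.1, G v w

/-- A `V₁`-saturating matching: a (total) injective map sending each vertex to a neighbour. -/
def IsSaturatingMatching {V₁ V₂ : Type*} (G : BipGraph V₁ V₂) (M : V₁ → V₂) : Prop :=
  Function.Injective M ∧ ∀ v, G v (M v)

/-- The order `max_a |f a|` of a map into a set whose elements have sizes. -/
def order {A B : Type*} [Fintype A] (size : B → ℕ) (f : A → B) : ℕ :=
  Finset.univ.sup fun a => size (f a)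

/-- The size of a vertex in the second class of `G⁺`. -/
def sizeOfSet {V : Type*} (B : {B : Finset V // B.Nonempty}) : ℕ := B.1.card

/-- A `V₁`-saturating matching whose order is smallest among all `V₁`-saturating matchings. -/
def IsMinSaturatingMatching {V₁ V₂ : Type*} [Fintype V₁] (G : BipGraph V₁ V₂) (size : V₂ → ℕ)
    (M : V₁ → V₂) : Prop :=
  IsSaturatingMatching G M ∧ ∀ M', IsSaturatingMatching G M' → order size M ≤ order size M'

/-- The saturating matching number: the smallest order of a `V₁`-saturating matching
(`⊤` if there is none). -/
noncomputable def smn {V₁ V₂ : Type*} [Fintype V₁] (G : BipGraph V₁ V₂) (size : V₂ → ℕ) : ℕ∞ :=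
  ⨅ (M : V₁ → V₂) (_ : IsSaturatingMatching G M), (order size M : ℕ∞)

/-! ### Learners and teachers, for unordered sampling without replacement -/

open Classical in
/-- The probability that `|A|`-fold unordered sampling without replacement, with probability
parameters `q`, returns the set `A`: the sum over all orderings `z₁, …, zₙ` of `A` of
`∏ i, q zᵢ / (1 - (q z₁ + ⋯ + q zᵢ₋₁))`. -/
noncomputable def sampleProb {Z : Type*} (q : Z → ℝ) (A : Finset Z) : ℝ :=
  ∑ σ : Fin A.card ≃ {z // z ∈ A},
    ∏ i : Fin A.card, q (σ i) / (1 - ∑ j ∈ Finset.Iio i, q (σ j))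

/-- A MAP-learner for a concept class `C` with observation set `Z` and consistency
relation `models`. -/
structure MAPLearner {C Z : Type*} [Fintype C] [Fintype Z] (models : C → Z → Prop) where
  /-- the prior `P(c)` -/
  prior : C → ℝ
  /-- the conditional likelihood `P(z | c)` -/
  lik : C → Z → ℝ
  prior_pos : ∀ c, 0 < prior c
  prior_sum : ∑ c, prior c = 1
  lik_nonneg : ∀ c z, 0 ≤ lik c z
  lik_sum : ∀ c, ∑ z, lik c z = 1
  valid : ∀ c z, ¬ models c z → lik c z = 0

namespace MAPLearner

variable {C Z : Type*} [Fintype C] [Fintype Z] {models : C → Z → Prop}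

/-- MLE-learners are the MAP-learners with uniform priors. -/
def IsMLE (L : MAPLearner models) : Prop := ∀ c c', L.prior c = L.prior c'

open Classical in
/-- The observations with positive `c`-conditional likelihood. -/
noncomputable def posObs (L : MAPLearner models) (c : C) : Finset Z :=
  Finset.univ.filter fun z => 0 < L.lik c z

/-- `min_c` of the number of observations with positive `c`-conditional likelihood. -/
noncomputable def minPos (L : MAPLearner models) : ℕ := ⨅ c, (L.posObs c).card

/-- `L`, in the mode of unordered sampling without replacement, returns `c₀` on input `A`:
the set `A` is not too large, and `c₀` is the unique maximizer of `P(c) * P(A | c)`. -/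
def Returns (L : MAPLearner models) (A : Finset Z) (c₀ : C) : Prop :=
  A.card ≤ L.minPos ∧
    ∀ c, c ≠ c₀ → L.prior c * sampleProb (L.lik c) A < L.prior c₀ * sampleProb (L.lik c₀) A

/-- `T` is a (successful) teacher for `L`. -/
def IsTeacher (L : MAPLearner models) (T : C → Finset Z) : Prop := ∀ c, L.Returns (T c) c

/-- The smallest order of a teacher for `L` (`⊤` if there is none). -/
noncomputable def maptd (L : MAPLearner models) : ℕ∞ :=
  ⨅ (T : C → Finset Z) (_ : L.IsTeacher T), (order Finset.card T : ℕ∞)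

end MAPLearner

/-- The MLE-teaching dimension for unordered sampling without replacement: the minimum
of `MAPLearner.maptd` over all MLE-learners. -/
noncomputable def mletd {C Z : Type*} [Fintype C] [Fintype Z] (models : C → Z → Prop) : ℕ∞ :=
  ⨅ (L : MAPLearner models) (_ : L.IsMLE), L.maptd

/-- Consistency of concepts with labeled examples, where the concept class is a family of subsets
of `X`. As a relation between concepts and observations it is also the consistency graph `G(C)`. -/
def labeled {C X : Type*} (concept : C → Finset X) : BipGraph C (X × Bool) :=
  fun c z => (z.2 = true ∧ z.1 ∈ concept c) ∨ (z.2 = false ∧ z.1 ∉ concept c)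

/-! ### The machine model

While-programs on binary trees (the data type of pure Lisp). A program transforms one tree.
Every execution of a construct on the current tree `x` is charged the full size of `x`, so that all
copying is paid for and the size of a result never exceeds the time spent on it; such programs and
multi-tape Turing machines simulate each other with polynomial overhead. -/

/-- Binary trees without labels. -/
inductive Data : Type
  | nil : Data
  | cons : Data → Data → Data

namespace Data

/-- The number of nodes. -/
def size : Data → ℕ
  | nil => 1
  | cons a b => 1 + a.size + b.size

/-- The left subtree (`nil` if there is none). -/
def head : Data → Data
  | nil => nil
  | cons a _ => a

/-- The right subtree (`nil` if there is none). -/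
def tail : Data → Data
  | nil => nil
  | cons _ b => b

end Data

/-- Programs. -/
inductive Prog : Type
  /-- leave the tree unchanged -/
  | id : Prog
  /-- return `nil` -/
  | nil : Prog
  /-- return the left subtree -/
  | head : Prog
  /-- return the right subtree -/
  | tail : Prog
  /-- run `p` and `q` on the same tree and join the results by a new root -/
  | pair (p q : Prog) : Prog
  /-- run `p`, then `q` on the result -/
  | seq (p q : Prog) : Prog
  /-- if `p` does not return `nil` then run `q`, else run `r`, on the original tree -/
  | branch (p q r : Prog) : Prog
  /-- while `p` does not return `nil` on the current tree, replace that tree by the result of `q` -/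
  | loop (p q : Prog) : Prog

/-- `Prog.Eval p x y t`: on input `x`, the program `p` halts with output `y` after time `t`.
The rules are deterministic. -/
inductive Prog.Eval : Prog → Data → Data → ℕ → Prop
  | id (x : Data) : Eval .id x x x.size
  | nil (x : Data) : Eval .nil x .nil x.size
  | head (x : Data) : Eval .head x x.head x.size
  | tail (x : Data) : Eval .tail x x.tail x.size
  | pair {p q : Prog} {x y z : Data} {s t : ℕ} :
      Eval p x y s → Eval q x z t → Eval (.pair p q) x (.cons y z) (x.size + s + t)
  | seq {p q : Prog} {x y z : Data} {s t : ℕ} :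
      Eval p x y s → Eval q y z t → Eval (.seq p q) x z (x.size + s + t)
  | branch_true {p q r : Prog} {x a b z : Data} {s t : ℕ} :
      Eval p x (.cons a b) s → Eval q x z t → Eval (.branch p q r) x z (x.size + s + t)
  | branch_false {p q r : Prog} {x z : Data} {s t : ℕ} :
      Eval p x .nil s → Eval r x z t → Eval (.branch p q r) x z (x.size + s + t)
  | loop_done {p q : Prog} {x : Data} {s : ℕ} :
      Eval p x .nil s → Eval (.loop p q) x x (x.size + s)
  | loop_step {p q : Prog} {x a b y z : Data} {s t u : ℕ} :
      Eval p x (.cons a b) s → Eval q x y t → Eval (.loop p q) y z u →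
        Eval (.loop p q) x z (x.size + s + t + u)

/-- Given instances `i` presented to the machine as `input i`, a tree `y` with `IsSolution i y`
can be computed in time polynomial in the parameter `param i`: one program and one polynomial
serve all instances. -/
def PolyTimeSolvable {ι : Type*} (param : ι → ℕ) (input : ι → Data)
    (IsSolution : ι → Data → Prop) : Prop :=
  ∃ (p : Prog) (bound : Polynomial ℕ), ∀ i : ι, ∃ (y : Data) (t : ℕ),
    p.Eval (input i) y t ∧ t ≤ bound.eval (param i) ∧ IsSolution i y

/-! ### Encodings -/

namespace Data

/-- Lists as right combs. -/
def ofList : List Data → Data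
  | [] => nil
  | a :: l => cons a (ofList l)

/-- Natural numbers in unary. -/
def ofNat (n : ℕ) : Data := ofList (List.replicate n nil)

open Classical in
/-- Truth values. -/
noncomputable def ofProp (P : Prop) : Data := if P then cons nil nil else nil

/-- Fractions: numerator and denominator. -/
def ofFrac (a b : ℕ) : Data := cons (ofNat a) (ofNat b)

/-- Tables with rows indexed by the list `r` and columns indexed by the list `s`. -/
def ofTable {α β : Type*} (r : List α) (s : List β) (f : α → β → Data) : Data :=
  ofList (r.map fun a => ofList (s.map fun b => f a b))

/-- A relation, encoded by the number of columns followed by its 0-1-matrix. -/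
noncomputable def ofRel {α β : Type*} (r : List α) (s : List β) (R : α → β → Prop) : Data :=
  cons (ofNat s.length) (ofTable r s fun a b => ofProp (R a b))

end Data

/-- A finite bipartite graph with numbered vertices. -/
structure GraphInstance where
  n : ℕ
  m : ℕ
  graph : BipGraph (Fin n) (Fin m)

namespace GraphInstance

/-- `|V₁| + |V₂|` -/
def param (I : GraphInstance) : ℕ := I.n + I.m

/-- The graph is presented by its adjacency matrix. -/
noncomputable def encode (I : GraphInstance) : Data :=
  Data.ofRel (List.finRange I.n) (List.finRange I.m) I.graph

/-- A map `v ↦ B_v` into the nonempty sets of vertices in `V₂` is presented by the matrix of the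
relation `w ∈ B_v`. -/
noncomputable def encodeMap (I : GraphInstance)
    (M : Fin I.n → {B : Finset (Fin I.m) // B.Nonempty}) : Data :=
  Data.ofRel (List.finRange I.n) (List.finRange I.m) fun v w => w ∈ (M v).1

end GraphInstance

/-- A family of `n ≥ 2` distinct subsets of a domain with `m` (numbered) elements. -/
structure ClassInstance where
  n : ℕ
  m : ℕ
  concept : Fin n → Finset (Fin m)
  injective : Function.Injective concept
  two_le : 2 ≤ n

namespace ClassInstance

/-- `|C| + |X|` -/
def param (I : ClassInstance) : ℕ := I.n + I.m

/-- The class is presented by its membership matrix. -/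
noncomputable def encode (I : ClassInstance) : Data :=
  Data.ofRel (List.finRange I.n) (List.finRange I.m) fun c x => x ∈ I.concept c

/-- The labeled examples. -/
abbrev Obs (I : ClassInstance) : Type := Fin I.m × Bool

/-- The consistency relation, alias the consistency graph `G(C)`. -/
abbrev models (I : ClassInstance) : BipGraph (Fin I.n) I.Obs := labeled I.concept

/-- All labeled examples, in a fixed order. -/
def obsList (I : ClassInstance) : List I.Obs :=
  (List.finRange I.m).flatMap fun x => [(x, false), (x, true)]

/-- The encoding of relations between concepts and labeled examples. -/
noncomputable def encodeRel (I : ClassInstance) (R : Fin I.n → I.Obs → Prop) : Data :=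
  Data.ofRel (List.finRange I.n) I.obsList R

/-- A map `c ↦ T c` into the sets of labeled examples is presented by the matrix of the
relation `z ∈ T c`. -/
noncomputable def encodeMap (I : ClassInstance) (T : Fin I.n → Finset I.Obs) : Data :=
  I.encodeRel fun c z => z ∈ T c

/-- `y` represents the learner `L`: it lists all priors and all conditional likelihoods
as fractions with positive denominators. -/
def RepresentsLearner (I : ClassInstance) (L : MAPLearner I.models) (y : Data) : Prop :=
  ∃ (a b : Fin I.n → ℕ) (a' b' : Fin I.n → I.Obs → ℕ),
    (∀ c, 0 < b c ∧ L.prior c = (a c : ℝ) / (b c : ℝ)) ∧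
    (∀ c z, 0 < b' c z ∧ L.lik c z = (a' c z : ℝ) / (b' c z : ℝ)) ∧
    y = Data.cons (Data.ofList ((List.finRange I.n).map fun c => Data.ofFrac (a c) (b c)))
      (Data.ofTable (List.finRange I.n) I.obsList fun c z => Data.ofFrac (a' c z) (b' c z))

end ClassInstance

end MLETeaching

open MLETeaching

namespace MLETeaching

/-! ### Polynomial-time functions between encoded types -/

/-! For the equality of the parameters: the sets used by a teacher are nonempty, consistent and
pairwise distinct, because each has a unique maximizer, so every teacher is a saturating matching
(`smn_le_mletd`). Conversely, let `M` be a matching and `m = |X|`. Let each concept `c` give weight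
`2m² + 1` to the examples in `M c` and weight 1 to its other consistent examples, and normalize.
Then `M c` is drawn from `c` with probability above 1/2 (`half_lt_sampleProb`). From any other
concept it is drawn with probability at most 1/2. Indeed, the probability is zero if `M c` is
inconsistent with that concept. Otherwise, exchanging one element for an outside one that is at
least as likely yields a different set of the same size and no smaller probability
(`sampleProb_le_map`), and two such sets have total probability at most 1 (`sampleProb_add_le`).
Hence `M` is a teacher (`isTeacher_matchingLearner`).

For the algorithm: a matching of order at most `d` is a system of distinct representatives for the
families of nonempty sets of at most `d` neighbours. These families may be exponentially large, but
with `n` vertices to saturate, a family with `n` members never violates Hall's condition, so the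
enumeration may be cut off (`candidates_complete`, `length_subsets_le`). Representatives are found
by an auction in which a queued bidder buys a cheapest acceptable item, if its price is below `n`,
for that price plus one, and displaces the former owner. Each sale raises the sum of prices by one,
and this sum never exceeds `n²`. If a bidder is finally unable to buy, an unused price level exposes
a Hall violator (`AuctionInv.false_of_stuck`). The least `d` for which the auction succeeds is the
minimum order (`minMatching_spec`).

For the running time: `PT` is closed under composition, pairing, branching and list folds whose
intermediate states have polynomial size (`PT.foldl`). Only the folds need size estimates; the rest
is assembled by `fun_prop`. Unary numbers are affordable because prices, weights and their sums are
polynomially bounded. -/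

/-- Types whose elements are presented to programs as trees. -/
class Enc (α : Type*) where
  /-- the tree that presents an element -/
  enc : α → Data

open Enc

instance : Enc Data := ⟨fun x => x⟩
instance : Enc Unit := ⟨fun _ => .nil⟩
instance : Enc Bool := ⟨fun b => bif b then .cons .nil .nil else .nil⟩
instance : Enc ℕ := ⟨Data.ofNat⟩
instance {α β : Type*} [Enc α] [Enc β] : Enc (α × β) := ⟨fun x => .cons (enc x.1) (enc x.2)⟩
instance {α : Type*} [Enc α] : Enc (List α) := ⟨fun l => .ofList (l.map enc)⟩

/-- The size of the tree that presents an element. -/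
def esize {α : Type*} [Enc α] (a : α) : ℕ := (enc a).size

/-- Functions computed by a program in time polynomial in the size of the input. -/
@[fun_prop] def PT {α β : Type*} [Enc α] [Enc β] (f : α → β) : Prop :=
  ∃ (p : Prog) (P : Polynomial ℕ), ∀ a, ∃ t, p.Eval (enc a) (enc (f a)) t ∧ t ≤ P.eval (esize a)

/-- Quantities bounded by a polynomial in the size of the input. -/
def PolyBdd {α : Type*} [Enc α] (s : α → ℕ) : Prop :=
  ∃ P : Polynomial ℕ, ∀ a, s a ≤ P.eval (esize a)

variable {ι α β γ : Type*} [Enc ι] [Enc α] [Enc β] [Enc γ]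

theorem polynomial_eval_mono (P : Polynomial ℕ) {a b : ℕ} (h : a ≤ b) : P.eval a ≤ P.eval b := by
  rw [Polynomial.eval_eq_sum, Polynomial.eval_eq_sum]
  exact Finset.sum_le_sum fun i _ => Nat.mul_le_mul_left _ (Nat.pow_le_pow_left h i)

namespace Data

theorem one_le_size (x : Data) : 1 ≤ x.size := by cases x <;> simp only [size] <;> omega

theorem size_head_le (x : Data) : x.head.size ≤ x.size := by
  cases x <;> simp [size, head]; omega

theorem size_tail_le (x : Data) : x.tail.size ≤ x.size := by
  cases x <;> simp [size, tail]

end Data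

/-- Every construct is charged at least the size of what it produces. A time bound is thus also a
size bound on the output, which is what makes polynomial time compose. -/
theorem Prog.Eval.size_le {p : Prog} {x y : Data} {t : ℕ} (h : p.Eval x y t) : y.size ≤ t := by
  induction h with
  | id x => exact le_rfl
  | nil x => exact x.one_le_size
  | head x => exact x.size_head_le
  | tail x => exact x.size_tail_le
  | @pair p q x y z s t _ _ h1 h2 =>
    have := x.one_le_size
    simp only [Data.size]; omega
  | seq _ _ _ h2 => omega
  | branch_true _ _ _ h2 => omega
  | branch_false _ _ _ h2 => omega
  | loop_done => omega
  | loop_step _ _ _ _ _ h => omega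

/-! #### Sizes -/

theorem esize_pair (a : α) (b : β) : esize (a, b) = 1 + esize a + esize b := rfl

theorem esize_fst_lt (x : α × β) : esize x.1 < esize x := by
  rw [← Prod.mk.eta (p := x), esize_pair]; dsimp only; omega

theorem esize_snd_lt (x : α × β) : esize x.2 < esize x := by
  rw [← Prod.mk.eta (p := x), esize_pair]; dsimp only; omega

@[simp] theorem esize_nil : esize ([] : List α) = 1 := rfl

@[simp] theorem esize_cons (a : α) (l : List α) : esize (a :: l) = 1 + esize a + esize l := rfl

theorem esize_list (l : List α) : esize l = 1 + (l.map fun a => 1 + esize a).sum := by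
  induction l with
  | nil => rfl
  | cons a l ih => rw [esize_cons, ih, List.map_cons, List.sum_cons]; omega

theorem esize_list_le {l : List α} {k : ℕ} (h : ∀ a ∈ l, esize a ≤ k) :
    esize l ≤ 1 + l.length * (1 + k) := by
  induction l with
  | nil => simp
  | cons a l ih =>
    have := ih fun a ha => h a (List.mem_cons_of_mem _ ha)
    have := h a List.mem_cons_self
    simp only [esize_cons, List.length_cons, Nat.succ_mul]; omega

theorem length_lt_esize (l : List α) : l.length < esize l := by
  induction l with
  | nil => simp
  | cons a l ih => simp only [esize_cons, List.length_cons]; omega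

theorem esize_le_of_mem {a : α} {l : List α} (h : a ∈ l) : esize a ≤ esize l := by
  induction l with
  | nil => simp at h
  | cons b l ih =>
    rcases List.mem_cons.1 h with rfl | h
    · simp only [esize_cons]; omega
    · have := ih h; simp only [esize_cons]; omega

theorem esize_nat (n : ℕ) : esize n = 2 * n + 1 := by
  induction n with
  | zero => rfl
  | succ n ih =>
    have : esize (n + 1) = 1 + 1 + esize n := rfl
    omega

theorem esize_bool_le (b : Bool) : esize b ≤ 3 := by cases b <;> decide

theorem esize_le_of_sublist {l₁ l₂ : List α} (h : l₁.Sublist l₂) : esize l₁ ≤ esize l₂ := by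
  induction h with
  | slnil => exact le_rfl
  | cons a _ ih => simp only [esize_cons]; omega
  | cons_cons a _ ih => simp only [esize_cons]; omega

/-! #### Polynomially bounded quantities -/

namespace PolyBdd

theorem mono {s t : α → ℕ} (ht : PolyBdd t) (h : ∀ a, s a ≤ t a) : PolyBdd s := by
  obtain ⟨P, hP⟩ := ht
  exact ⟨P, fun a => (h a).trans (hP a)⟩

theorem const (k : ℕ) : PolyBdd (fun _ : α => k) := ⟨Polynomial.C k, by simp⟩

theorem add {s t : α → ℕ} (hs : PolyBdd s) (ht : PolyBdd t) : PolyBdd (fun a => s a + t a) := by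
  obtain ⟨P, hP⟩ := hs
  obtain ⟨Q, hQ⟩ := ht
  exact ⟨P + Q, fun a => by rw [Polynomial.eval_add]; exact Nat.add_le_add (hP a) (hQ a)⟩

theorem mul {s t : α → ℕ} (hs : PolyBdd s) (ht : PolyBdd t) : PolyBdd (fun a => s a * t a) := by
  obtain ⟨P, hP⟩ := hs
  obtain ⟨Q, hQ⟩ := ht
  exact ⟨P * Q, fun a => by rw [Polynomial.eval_mul]; exact Nat.mul_le_mul (hP a) (hQ a)⟩

theorem esize : PolyBdd (fun a : α => esize a) := ⟨Polynomial.X, by simp⟩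

theorem eval {s : α → ℕ} (hs : PolyBdd s) (P : Polynomial ℕ) :
    PolyBdd (fun a => P.eval (s a)) := by
  obtain ⟨Q, hQ⟩ := hs
  exact ⟨P.comp Q, fun a => by
    rw [Polynomial.eval_comp]; exact polynomial_eval_mono P (hQ a)⟩

theorem of_PT {f : α → β} (hf : PT f) : PolyBdd (fun a => MLETeaching.esize (f a)) := by
  obtain ⟨p, P, h⟩ := hf
  refine ⟨P, fun a => ?_⟩
  obtain ⟨t, h1, h2⟩ := h a
  exact h1.size_le.trans h2

theorem length {f : α → List β} (hf : PT f) : PolyBdd (fun a => (f a).length) :=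
  (of_PT hf).mono fun _ => (length_lt_esize _).le

end PolyBdd

/-- To compute in polynomial time it is enough to respect a polynomially bounded time limit. -/
theorem PT.of_polyBdd {f : α → β} (p : Prog) {s : α → ℕ} (hs : PolyBdd s)
    (h : ∀ a, ∃ t, p.Eval (enc a) (enc (f a)) t ∧ t ≤ s a) : PT f := by
  obtain ⟨P, hP⟩ := hs
  refine ⟨p, P, fun a => ?_⟩
  obtain ⟨t, h1, h2⟩ := h a
  exact ⟨t, h1, h2.trans (hP a)⟩

/-! #### Basic closure properties -/

theorem Prog.exists_const (y : Data) : ∃ (p : Prog) (k : ℕ), ∀ x, ∃ t, p.Eval x y t ∧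
    t ≤ k * x.size := by
  induction y with
  | nil => exact ⟨.nil, 1, fun x => ⟨_, .nil x, by simp⟩⟩
  | cons y z ihy ihz =>
    obtain ⟨p, k, hp⟩ := ihy
    obtain ⟨q, l, hq⟩ := ihz
    refine ⟨.pair p q, 1 + k + l, fun x => ?_⟩
    obtain ⟨s, h1, h2⟩ := hp x
    obtain ⟨t, h3, h4⟩ := hq x
    exact ⟨_, .pair h1 h3, by nlinarith⟩

namespace PT

@[fun_prop] theorem id : PT (fun a : α => a) :=
  of_polyBdd .id .esize fun _ => ⟨_, .id _, le_rfl⟩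

@[fun_prop] theorem const (b : β) : PT (fun _ : α => b) := by
  obtain ⟨p, k, h⟩ := Prog.exists_const (enc b)
  exact of_polyBdd p ((PolyBdd.const k).mul .esize) fun a => h _

@[fun_prop] theorem comp {f : β → γ} {g : α → β} (hf : PT f) (hg : PT g) :
    PT (fun a => f (g a)) := by
  have hb := PolyBdd.of_PT hg
  obtain ⟨p, P, h⟩ := hf
  obtain ⟨q, Q, k⟩ := hg
  refine of_polyBdd (.seq q p) ((PolyBdd.esize.add (PolyBdd.esize.eval Q)).add (hb.eval P))
    fun a => ?_
  obtain ⟨s, h1, h2⟩ := k a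
  obtain ⟨t, h3, h4⟩ := h (g a)
  exact ⟨_, .seq h1 h3, Nat.add_le_add (Nat.add_le_add le_rfl h2) h4⟩

@[fun_prop] theorem fst {f : α → β × γ} (hf : PT f) : PT (fun a => (f a).1) :=
  comp (f := Prod.fst) (of_polyBdd .head .esize fun _ => ⟨_, .head _, le_rfl⟩) hf

@[fun_prop] theorem snd {f : α → β × γ} (hf : PT f) : PT (fun a => (f a).2) :=
  comp (f := Prod.snd) (of_polyBdd .tail .esize fun _ => ⟨_, .tail _, le_rfl⟩) hf

@[fun_prop] theorem pair {f : α → β} {g : α → γ} (hf : PT f) (hg : PT g) :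
    PT (fun a => (f a, g a)) := by
  obtain ⟨p, P, h⟩ := hf
  obtain ⟨q, Q, k⟩ := hg
  refine of_polyBdd (.pair p q) ((PolyBdd.esize.add (PolyBdd.esize.eval P)).add
    (PolyBdd.esize.eval Q)) fun a => ?_
  obtain ⟨s, h1, h2⟩ := h a
  obtain ⟨t, h3, h4⟩ := k a
  exact ⟨_, .pair h1 h3, Nat.add_le_add (Nat.add_le_add le_rfl h2) h4⟩

@[fun_prop] theorem cond {c : α → Bool} {f g : α → β} (hc : PT c) (hf : PT f) (hg : PT g) :
    PT (fun a => bif c a then f a else g a) := by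
  obtain ⟨r, R, l⟩ := hc
  obtain ⟨p, P, h⟩ := hf
  obtain ⟨q, Q, k⟩ := hg
  refine of_polyBdd (.branch r p q) (((PolyBdd.esize.add (PolyBdd.esize.eval R)).add
    (PolyBdd.esize.eval P)).add (PolyBdd.esize.eval Q)) fun a => ?_
  obtain ⟨s, h1, h2⟩ := l a
  obtain ⟨t, h3, h4⟩ := h a
  obtain ⟨u, h5, h6⟩ := k a
  cases hca : c a
  · rw [hca] at h1
    exact ⟨_, .branch_false h1 h5, by simp only [esize] at *; omega⟩
  · rw [hca] at h1
    exact ⟨_, .branch_true h1 h3, by simp only [esize] at *; omega⟩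

@[fun_prop] theorem isEmpty {f : ι → List α} (hf : PT f) : PT (fun i => (f i).isEmpty) := by
  refine comp (f := List.isEmpty) (of_polyBdd (.branch .id .nil (.pair .nil .nil))
    ((((PolyBdd.esize.add .esize).add .esize).add .esize).add .esize) fun l => ?_) hf
  cases l with
  | nil => exact ⟨_, .branch_false (.id _) (.pair (.nil _) (.nil _)), by simp only [esize]; omega⟩
  | cons a l => exact ⟨_, .branch_true (.id _) (.nil _), by simp only [esize]; omega⟩

@[fun_prop] theorem tail {f : ι → List α} (hf : PT f) : PT (fun i => (f i).tail) :=
  comp (f := List.tail) (of_polyBdd .tail .esize fun l => ⟨_, by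
    cases l <;> exact .tail _, le_rfl⟩) hf

-- A nonempty list and the pair of its head and tail are the same tree, so the program for the pair
-- serves unchanged.
@[fun_prop] theorem cons {f : ι → α} {g : ι → List α} (hf : PT f) (hg : PT g) :
    PT (fun i => f i :: g i) := by
  obtain ⟨p, P, h⟩ := pair hf hg
  exact ⟨p, P, h⟩

@[fun_prop] theorem headD {f : ι → List α} {d : ι → α} (hf : PT f) (hd : PT d) :
    PT (fun i => (f i).headD (d i)) := by
  have h : PT (fun x : List α × α => x.1.headD x.2) := by
    refine of_polyBdd (.branch .head (.seq .head .head) .tail)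
      ((((PolyBdd.esize.add .esize).add .esize).add .esize).add .esize) fun ⟨l, d⟩ => ?_
    have h0 := Data.size_head_le (enc (l, d))
    cases l with
    | nil => exact ⟨_, .branch_false (.head _) (.tail _), by simp only [esize]; omega⟩
    | cons a l =>
      exact ⟨_, .branch_true (.head _) (.seq (.head _) (.head _)), by simp only [esize]; omega⟩
  exact h.comp (pair hf hd)

/-! #### Folds -/

/-- The loop state is the triple of parameter, accumulator and remaining list. The double tail of
its tree is the remaining list, which is `nil` exactly when the fold is finished. `K` bounds all
states that occur, so the cost per round is uniform. -/
theorem loop_foldl {f : ι → β → α → β} {p : Prog} {P : Polynomial ℕ}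
    (hp : ∀ x : ι × β × α × List α, ∃ t, p.Eval (enc x)
      (enc (x.1, f x.1 x.2.1 x.2.2.1, x.2.2.2)) t ∧ t ≤ P.eval (esize x))
    (i : ι) {K : ℕ} (l : List α) (b : β)
    (hK : ∀ l₁ l₂, l₁ ++ l₂ = l → esize (i, l₁.foldl (f i) b, l₂) ≤ K) :
    ∃ t, (Prog.loop (.seq .tail .tail) p).Eval (enc (i, b, l))
      (enc (i, l.foldl (f i) b, ([] : List α))) t ∧
      t ≤ (l.length + 1) * (5 * K + P.eval K) := by
  induction l generalizing b with
  | nil =>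
    have h := hK [] [] rfl
    refine ⟨_, .loop_done (.seq (.tail _) (.tail _)), ?_⟩
    have := Data.size_tail_le (enc (i, b, ([] : List α)))
    simp only [esize, List.foldl_nil] at h
    simp only [List.length_nil]
    omega
  | cons a l ih =>
    have h := hK [] (a :: l) rfl
    simp only [List.foldl_nil] at h
    obtain ⟨t, h1, h2⟩ := hp (i, b, a, l)
    obtain ⟨u, h3, h4⟩ := ih (f i b a) fun l₁ l₂ hl => by
      simpa using hK (a :: l₁) l₂ (by simp [hl])
    refine ⟨_, .loop_step (a := enc a) (b := enc l) (.seq (.tail _) (.tail _)) h1 h3, ?_⟩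
    have h5 : P.eval (esize (i, b, a, l)) ≤ P.eval K := polynomial_eval_mono P h
    have := Data.size_tail_le (enc (i, b, a :: l))
    simp only [esize] at h
    have h6 : (l.length + 1 + 1) * (5 * K + P.eval K) =
      (l.length + 1) * (5 * K + P.eval K) + (5 * K + P.eval K) := Nat.succ_mul _ _
    rw [List.length_cons, h6]
    omega

/-- A polynomial-time step alone is not enough, since a state that doubles in each round grows
exponentially. Hence the hypothesis that the states after all prefixes of the list stay below one
polynomially bounded `s`. -/
theorem foldl {f : ι → β → α → β} {b : ι → β} {l : ι → List α} {s : ι → ℕ}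
    (hf : PT (fun x : ι × β × α => f x.1 x.2.1 x.2.2)) (hb : PT b) (hl : PT l) (hs : PolyBdd s)
    (h : ∀ i l₁ l₂, l₁ ++ l₂ = l i → esize (l₁.foldl (f i) (b i)) ≤ s i) :
    PT (fun i => (l i).foldl (f i) (b i)) := by
  have hstep : PT (fun x : ι × β × α × List α => (x.1, f x.1 x.2.1 x.2.2.1, x.2.2.2)) := by
    have : PT (fun x : ι × β × α × List α => f x.1 x.2.1 x.2.2.1) :=
      comp (g := fun x : ι × β × α × List α => (x.1, x.2.1, x.2.2.1)) hf (by fun_prop)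
    fun_prop
  have hlen := PolyBdd.length hl
  have hlb := PolyBdd.of_PT hl
  obtain ⟨p, P, hp⟩ := hstep
  obtain ⟨q, Q, hq⟩ := pair id (pair hb hl)
  have hK := ((PolyBdd.const 2).add (.esize (α := ι))).add (hs.add hlb)
  refine of_polyBdd (.seq q (.seq (.loop (.seq .tail .tail) p) (.seq .tail .head)))
    ((((PolyBdd.esize.add (.eval .esize Q)).add ((hlen.add (.const 1)).mul
      (((PolyBdd.const 5).mul hK).add (hK.eval P)))).add ((PolyBdd.const 4).mul hK))) fun i => ?_
  have hsize : ∀ l₁ l₂, l₁ ++ l₂ = l i → esize (i, l₁.foldl (f i) (b i), l₂) ≤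
      2 + esize i + (s i + esize (l i)) := fun l₁ l₂ hl => by
    have h1 := h i l₁ l₂ hl
    have h2 := esize_le_of_sublist (hl ▸ List.sublist_append_right l₁ l₂)
    simp only [esize_pair]; omega
  obtain ⟨t, h1, h2⟩ := hq i
  obtain ⟨u, h3, h4⟩ := loop_foldl hp i (l i) (b i) hsize
  refine ⟨_, .seq h1 (.seq h3 (.seq (.tail _) (.head _))), ?_⟩
  have h5 := hsize (l i) [] (by simp)
  have h6 := hsize [] (l i) (by simp)
  have h7 := Data.size_tail_le (enc (i, (l i).foldl (f i) (b i), ([] : List α)))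
  simp only [esize, List.foldl_nil] at *
  omega

/-- Folds in which each step adds a bounded amount to the size of the state. -/
theorem foldl_of_add {f : ι → β → α → β} {b : ι → β} {l : ι → List α} {s : ι → ℕ}
    (hf : PT (fun x : ι × β × α => f x.1 x.2.1 x.2.2)) (hb : PT b) (hl : PT l) (hs : PolyBdd s)
    (h : ∀ i b', ∀ a ∈ l i, esize (f i b' a) ≤ esize b' + s i) :
    PT (fun i => (l i).foldl (f i) (b i)) := by
  refine foldl hf hb hl ((PolyBdd.of_PT hb).add ((PolyBdd.length hl).mul hs)) fun i l₁ l₂ hl => ?_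
  have : ∀ l₁ : List α, (∀ a ∈ l₁, a ∈ l i) →
      esize (l₁.foldl (f i) (b i)) ≤ esize (b i) + l₁.length * s i := by
    intro l₁
    induction l₁ using List.reverseRecOn with
    | nil => simp
    | append_singleton l₁ a ih =>
      intro hl
      have h1 := ih fun a ha => hl a (by simp [ha])
      have h2 := h i (l₁.foldl (f i) (b i)) a (hl a (by simp))
      simp only [List.foldl_append, List.foldl_cons, List.foldl_nil, List.length_append,
        List.length_cons, List.length_nil, Nat.zero_add, Nat.succ_mul]
      omega
  refine (this l₁ fun a ha => by simp [← hl, ha]).trans ?_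
  refine Nat.add_le_add_left (Nat.mul_le_mul_right _ ?_) _
  simp [← hl]

@[fun_prop] theorem reverse {l : ι → List α} (hl : PT l) : PT (fun i => (l i).reverse) := by
  have : PT (fun i => (l i).foldl (fun r a => a :: r) []) :=
    foldl_of_add (f := fun _ r a => a :: r) (by fun_prop) (by fun_prop) hl
      ((PolyBdd.const 1).add (PolyBdd.of_PT hl)) fun i r a ha => by
        have := esize_le_of_mem ha
        simp only [esize_cons]; omega
  simpa [List.foldl_flip_cons_eq_append'] using this

theorem foldr {f : ι → α → β → β} {b : ι → β} {l : ι → List α} {s : ι → ℕ}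
    (hf : PT (fun x : ι × α × β => f x.1 x.2.1 x.2.2)) (hb : PT b) (hl : PT l) (hs : PolyBdd s)
    (h : ∀ i l₁ l₂, l₁ ++ l₂ = l i → esize (l₂.foldr (f i) (b i)) ≤ s i) :
    PT (fun i => (l i).foldr (f i) (b i)) := by
  have h1 : PT (fun x : ι × β × α => f x.1 x.2.2 x.2.1) :=
    comp (g := fun x : ι × β × α => (x.1, x.2.2, x.2.1)) hf (by fun_prop)
  have := foldl (f := fun i x a => f i a x) h1 hb hl.reverse hs fun i l₁ l₂ hl => by
    have := h i l₂.reverse l₁.reverse (by rw [← List.reverse_append, hl, List.reverse_reverse])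
    rwa [List.foldr_reverse] at this
  simpa only [List.foldl_reverse] using this

theorem foldr_of_add {f : ι → α → β → β} {b : ι → β} {l : ι → List α} {s : ι → ℕ}
    (hf : PT (fun x : ι × α × β => f x.1 x.2.1 x.2.2)) (hb : PT b) (hl : PT l) (hs : PolyBdd s)
    (h : ∀ i b', ∀ a ∈ l i, esize (f i a b') ≤ esize b' + s i) :
    PT (fun i => (l i).foldr (f i) (b i)) := by
  have h1 : PT (fun x : ι × β × α => f x.1 x.2.2 x.2.1) :=
    comp (g := fun x : ι × β × α => (x.1, x.2.2, x.2.1)) hf (by fun_prop)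
  have := foldl_of_add (f := fun i x a => f i a x) h1 hb hl.reverse hs fun i b' a ha =>
    h i b' a (by simpa using ha)
  simpa only [List.foldl_reverse] using this

/-- Folds in which each step keeps the state or replaces it by something of bounded size. -/
theorem foldr_of_max {f : ι → α → β → β} {b : ι → β} {l : ι → List α} {s : ι → ℕ}
    (hf : PT (fun x : ι × α × β => f x.1 x.2.1 x.2.2)) (hb : PT b) (hl : PT l) (hs : PolyBdd s)
    (h : ∀ i b', ∀ a ∈ l i, esize (f i a b') ≤ max (esize b') (s i)) :
    PT (fun i => (l i).foldr (f i) (b i)) := by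
  refine foldr hf hb hl ((PolyBdd.of_PT hb).add hs) fun i l₁ l₂ hl => ?_
  have : ∀ l₂ : List α, (∀ a ∈ l₂, a ∈ l i) →
      esize (l₂.foldr (f i) (b i)) ≤ esize (b i) + s i := by
    intro l₂
    induction l₂ with
    | nil => simp
    | cons a l₂ ih =>
      intro hl
      have h1 := ih fun a ha => hl a (by simp [ha])
      have h2 := h i (l₂.foldr (f i) (b i)) a (hl a (by simp))
      rw [List.foldr_cons]
      omega
  exact this l₂ fun a ha => by simp [← hl, ha]

/-! #### Lists -/

theorem polyBdd_mem {l : ι → List α} (hl : PT l) {f : ι → α → β}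
    (hf : PT (fun x : ι × α => f x.1 x.2)) :
    ∃ s : ι → ℕ, PolyBdd s ∧ ∀ i, ∀ a ∈ l i, esize (f i a) ≤ s i := by
  obtain ⟨P, hP⟩ := PolyBdd.of_PT hf
  refine ⟨_, (((PolyBdd.const 1).add .esize).add (PolyBdd.of_PT hl)).eval P, fun i a ha => ?_⟩
  refine (hP (i, a)).trans (polynomial_eval_mono P ?_)
  have := esize_le_of_mem ha
  rw [esize_pair]; omega

@[fun_prop] theorem map {f : ι → α → β} {l : ι → List α} (hf : PT (fun x : ι × α => f x.1 x.2))
    (hl : PT l) : PT (fun i => (l i).map (f i)) := by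
  obtain ⟨s, hs, h⟩ := polyBdd_mem hl hf
  have h1 : PT (fun x : ι × α × List β => f x.1 x.2.1) :=
    comp (g := fun x : ι × α × List β => (x.1, x.2.1)) hf (by fun_prop)
  have := foldr_of_add (f := fun i a r => f i a :: r) (b := fun _ => []) (h1.cons (by fun_prop))
    (const _) hl ((PolyBdd.const 1).add hs) fun i r a ha => by
      have := h i a ha
      rw [esize_cons]; omega
  refine cast (congrArg PT (funext fun i => ?_)) this
  induction l i <;> simp [*]

@[fun_prop] theorem append {f g : ι → List α} (hf : PT f) (hg : PT g) :
    PT (fun i => f i ++ g i) := by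
  have := foldr_of_add (f := fun _ a r => a :: r) (by fun_prop) hg hf
    ((PolyBdd.const 1).add (PolyBdd.of_PT hf)) fun i r a ha => by
      have := esize_le_of_mem ha
      rw [esize_cons]; omega
  simpa using this

@[fun_prop] theorem flatMap {f : ι → α → List β} {l : ι → List α}
    (hf : PT (fun x : ι × α => f x.1 x.2)) (hl : PT l) : PT (fun i => (l i).flatMap (f i)) := by
  obtain ⟨s, hs, h⟩ := polyBdd_mem hl hf
  have h1 : PT (fun x : ι × α × List β => f x.1 x.2.1) :=
    comp (g := fun x : ι × α × List β => (x.1, x.2.1)) hf (by fun_prop)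
  have := foldr_of_add (f := fun i a r => f i a ++ r) (b := fun _ => []) (h1.append (by fun_prop))
    (const _) hl hs fun i r a ha => by
      have := h i a ha
      rw [esize_list] at this
      rw [esize_list, esize_list r, List.map_append, List.sum_append]; omega
  refine cast (congrArg PT (funext fun i => ?_)) this
  induction l i <;> simp [*]

@[fun_prop] theorem filter {p : ι → α → Bool} {l : ι → List α}
    (hp : PT (fun x : ι × α => p x.1 x.2)) (hl : PT l) : PT (fun i => (l i).filter (p i)) := by
  have h : PT (fun i => (l i).flatMap fun a => bif p i a then [a] else []) := by fun_prop
  refine cast (congrArg PT (funext fun i => ?_)) h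
  induction l i with
  | nil => rfl
  | cons a l ih => cases h : p i a <;> simp [*]

-- The fold runs along the first list; its state holds the unused part of the second list and the
-- pairs made so far, in reverse order.
@[fun_prop] theorem zip {f : ι → List α} {g : ι → List β} (hf : PT f) (hg : PT g) :
    PT (fun i => (f i).zip (g i)) := by
  -- The element `d` is only a default for `headD`, which is never reached on an empty list here.
  rcases isEmpty_or_nonempty β with hβ | ⟨⟨d⟩⟩
  · simpa [Subsingleton.elim _ ([] : List β)] using const (α := ι) ([] : List (α × β))
  have h1 := foldl_of_add (ι := ι) (l := f) (b := fun i => (g i, ([] : List (α × β))))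
    (f := fun _ st a =>
      bif st.1.isEmpty then st else (st.1.tail, (a, st.1.headD d) :: st.2))
    (by fun_prop) (by fun_prop) hf ((PolyBdd.const 1).add (PolyBdd.of_PT hf)) fun i st a ha => by
      obtain ⟨_ | ⟨b, r⟩, s⟩ := st
      · exact Nat.le_add_right _ _
      · have := esize_le_of_mem ha
        simp only [List.isEmpty_cons, cond_false, esize_pair, esize_cons, List.tail_cons,
          List.headD_cons]
        omega
  have key : ∀ (l : List α) (r : List β) (s : List (α × β)), (l.foldl (fun st a =>
      bif st.1.isEmpty then st else (st.1.tail, (a, st.1.headD d) :: st.2)) (r, s)).2 =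
      (l.zip r).reverse ++ s := by
    intro l
    induction l with
    | nil => simp
    | cons a l ih =>
      intro r s
      cases r with
      | nil => simpa using ih [] s
      | cons b r => simpa using ih r ((a, b) :: s)
  have h2 := h1.snd.reverse
  simp only [key] at h2
  simpa using h2

/-! #### Truth values -/

@[fun_prop] theorem not {f : ι → Bool} (hf : PT f) : PT (fun i => !f i) := by
  have h : PT (fun i => bif f i then false else true) := by fun_prop
  refine cast (congrArg PT (funext fun i => ?_)) h
  cases f i <;> rfl

@[fun_prop] theorem and {f g : ι → Bool} (hf : PT f) (hg : PT g) : PT (fun i => f i && g i) := by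
  have h : PT (fun i => bif f i then g i else false) := by fun_prop
  refine cast (congrArg PT (funext fun i => ?_)) h
  cases f i <;> rfl

@[fun_prop] theorem all {p : ι → α → Bool} {l : ι → List α}
    (hp : PT (fun x : ι × α => p x.1 x.2)) (hl : PT l) : PT (fun i => (l i).all (p i)) := by
  have h : PT (fun i => ((l i).filter fun a => !p i a).isEmpty) := by fun_prop
  refine cast (congrArg PT (funext fun i => ?_)) h
  rw [Bool.eq_iff_iff]
  simp

/-! #### Natural numbers -/

/-- A unary number and a list of units are the same tree, so arithmetic reduces to operations on
lists. -/
theorem enc_replicate (n : ℕ) : enc (List.replicate n ()) = enc n :=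
  congrArg Data.ofList (List.map_replicate ..)

@[fun_prop] theorem replicate_unit {f : ι → ℕ} (hf : PT f) :
    PT (fun i => List.replicate (f i) ()) := by
  refine comp (f := fun n => List.replicate n ()) (of_polyBdd .id .esize fun n => ?_) hf
  rw [enc_replicate]
  exact ⟨_, .id _, le_rfl⟩

@[fun_prop] theorem length {l : ι → List α} (hl : PT l) : PT (fun i => (l i).length) := by
  have h : PT (fun r : List Unit => r.length) := by
    refine of_polyBdd .id .esize fun r => ?_
    have : enc r.length = enc r := by
      rw [← enc_replicate]; congr 1; exact (List.eq_replicate_of_mem fun _ _ => rfl).symm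
    rw [this]
    exact ⟨_, .id _, le_rfl⟩
  have : PT (fun i => ((l i).map fun _ => ()).length) := by fun_prop
  simpa using this

@[fun_prop] theorem add {f g : ι → ℕ} (hf : PT f) (hg : PT g) : PT (fun i => f i + g i) := by
  have : PT (fun i => (List.replicate (f i) () ++ List.replicate (g i) ()).length) := by fun_prop
  simpa using this

@[fun_prop] theorem sub {f g : ι → ℕ} (hf : PT f) (hg : PT g) : PT (fun i => f i - g i) := by
  have h1 : PT (fun n : ℕ => n - 1) := by
    have : PT (fun n => (List.replicate n ()).tail.length) := by fun_prop
    simpa using this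
  have h2 := foldr_of_max (ι := ι) (l := fun i => List.replicate (g i) ()) (b := f)
    (f := fun _ _ r => r - 1) (h1.comp (by fun_prop)) hf (by fun_prop) (.const 0)
    fun i r _ _ => by simp only [esize_nat]; omega
  refine cast (congrArg PT (funext fun i => ?_)) h2
  induction g i with
  | zero => rfl
  | succ n ih => rw [List.replicate_succ, List.foldr_cons, ih]; omega

@[fun_prop] theorem mul {f g : ι → ℕ} (hf : PT f) (hg : PT g) : PT (fun i => f i * g i) := by
  have h := foldr_of_add (ι := ι) (l := fun i => List.replicate (g i) ()) (b := fun _ => 0)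
    (f := fun i _ r => r + f i) ((PT.snd (.snd .id)).add (hf.comp (.fst .id))) (by fun_prop)
    (by fun_prop) (PolyBdd.of_PT hf) fun i r _ _ => by simp only [esize_nat]; omega
  refine cast (congrArg PT (funext fun i => ?_)) h
  induction g i with
  | zero => rfl
  | succ n ih => rw [List.replicate_succ, List.foldr_cons, ih, Nat.mul_succ]

@[fun_prop] theorem decide_lt {f g : ι → ℕ} (hf : PT f) (hg : PT g) :
    PT (fun i => decide (f i < g i)) := by
  have h : PT (fun i => !(List.replicate (g i - f i) ()).isEmpty) := by fun_prop
  refine cast (congrArg PT (funext fun i => ?_)) h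
  rw [Bool.eq_iff_iff]
  simp [Nat.sub_eq_zero_iff_le]

@[fun_prop] theorem decide_eq_nat {f g : ι → ℕ} (hf : PT f) (hg : PT g) :
    PT (fun i => decide (f i = g i)) := by
  have h : PT (fun i => !decide (f i < g i) && !decide (g i < f i)) := by fun_prop
  refine cast (congrArg PT (funext fun i => ?_)) h
  rw [Bool.eq_iff_iff]
  simp only [Bool.and_eq_true, Bool.not_eq_true', decide_eq_false_iff_not, decide_eq_true_eq]
  omega

@[fun_prop] theorem decide_eq_bools {f g : ι → List Bool} (hf : PT f) (hg : PT g) :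
    PT (fun i => decide (f i = g i)) := by
  have h : PT (fun i => decide ((f i).length = (g i).length) &&
      ((f i).zip (g i)).all fun x => bif x.1 then x.2 else !x.2) := by fun_prop
  refine cast (congrArg PT (funext fun i => ?_)) h
  rw [Bool.eq_iff_iff]
  generalize f i = l
  generalize g i = r
  rw [decide_eq_true_eq]
  induction l generalizing r with
  | nil => cases r <;> simp
  | cons a l ih =>
    cases r with
    | nil => simp
    | cons b r =>
      rw [List.cons.injEq, ← ih]
      cases a <;> cases b <;> simp

@[fun_prop] theorem range {f : ι → ℕ} (hf : PT f) : PT (fun i => List.range (f i)) := by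
  have key : ∀ n, (List.replicate n ()).foldl (fun r _ => r ++ [r.length]) [] = List.range n := by
    intro n
    induction n with
    | zero => rfl
    | succ n ih => rw [List.replicate_succ', List.foldl_append, ih]; simp [List.range_succ]
  -- The amount added grows with the state, so the size is read off the closed form `key` of the
  -- intermediate states.
  have h := foldl (ι := ι) (l := fun i => List.replicate (f i) ()) (b := fun _ => [])
    (f := fun _ r _ => r ++ [r.length]) (s := fun i => 1 + esize (f i) * (1 + esize (f i)))
    (by fun_prop) (by fun_prop) (by fun_prop)
    ((PolyBdd.const 1).add ((PolyBdd.of_PT hf).mul ((PolyBdd.const 1).add (PolyBdd.of_PT hf))))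
    fun i l₁ l₂ hl => by
      have h1 : l₁ = List.replicate l₁.length () := List.eq_replicate_of_mem fun _ _ => rfl
      have h2 : l₁.length ≤ f i := by
        have := congrArg List.length hl
        rw [List.length_append, List.length_replicate] at this
        omega
      rw [h1, key]
      refine (esize_list_le (k := esize (f i)) fun a ha => ?_).trans
        (Nat.add_le_add_left (Nat.mul_le_mul_right _ ?_) _)
      · have := List.mem_range.1 ha
        rw [esize_nat, esize_nat]; omega
      · rw [List.length_range, esize_nat]; omega
  simpa only [key] using h

/-- Polynomial-time functions solve the problems whose instances they map to solutions. -/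
theorem polyTimeSolvable {κ : Type*} {F : α → β} (hF : PT F) {param : κ → ℕ} {input : κ → Data}
    {IsSolution : κ → Data → Prop} (inp : κ → α) (hinp : ∀ k, enc (inp k) = input k)
    (Q : Polynomial ℕ) (hQ : ∀ k, esize (inp k) ≤ Q.eval (param k))
    (h : ∀ k, IsSolution k (enc (F (inp k)))) : PolyTimeSolvable param input IsSolution := by
  obtain ⟨p, P, hp⟩ := hF
  refine ⟨p, P.comp Q, fun k => ?_⟩
  obtain ⟨t, h1, h2⟩ := hp (inp k)
  refine ⟨_, t, hinp k ▸ h1, h2.trans ?_, h k⟩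
  rw [Polynomial.eval_comp]
  exact polynomial_eval_mono P (hQ k)

end PT
/-! ### Systems of distinct representatives by an auction -/

/-- A bidder: a name and a list of acceptable items. -/
abbrev Bidder := ℕ × List (List Bool)

/-- A sold item: its owner, the item and its price. -/
abbrev Sale := Bidder × List Bool × ℕ

/-- The price of an item; unsold items are free. -/
def price (A : List Sale) (s : List Bool) : ℕ :=
  A.foldr (fun e r => bif decide (e.2.1 = s) then e.2.2 else r) 0

/-- The smallest price below `n` of an item of the list, together with such an item
(the pair `(n, [])` if there is none). -/
def bestOffer (n : ℕ) (A : List Sale) (l : List (List Bool)) : ℕ × List Bool :=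
  l.foldr (fun s r => bif decide (price A s < r.1) then (price A s, s) else r) (n, [])

/-- Sell the item `r.2` to `b` at the price `r.1 + 1`; its previous owner joins the queue. -/
def sell (A : List Sale) (q : List Bidder) (b : Bidder) (r : ℕ × List Bool) :
    List Sale × List Bidder :=
  ((b, r.2, r.1 + 1) :: A.filter (fun e => !decide (e.2.1 = r.2)),
    (A.filter fun e => decide (e.2.1 = r.2)).map Prod.fst ++ q)

/-- One step of the auction: the first bidder of the queue buys a cheapest acceptable item,
provided that its price is less than `n`. -/
def auctionStep (n : ℕ) (st : List Sale × List Bidder) : List Sale × List Bidder :=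
  bif st.2.isEmpty then st
  else bif decide ((bestOffer n st.1 (st.2.headD (0, [])).2).1 < n) then
    sell st.1 st.2.tail (st.2.headD (0, [])) (bestOffer n st.1 (st.2.headD (0, [])).2)
  else st

/-- The state reached after sufficiently many steps. -/
def auction (bs : List Bidder) : List Sale × List Bidder :=
  (List.replicate (bs.length * bs.length + 1) ()).foldl (fun st _ => auctionStep bs.length st)
    ([], bs)

/-! #### Correctness -/

theorem exists_of_price_pos {A : List Sale} {s : List Bool} (h : 0 < price A s) :
    ∃ e ∈ A, e.2.1 = s ∧ e.2.2 = price A s := by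
  induction A with
  | nil => simp [price] at h
  | cons a A ih =>
    have h1 : price (a :: A) s = bif decide (a.2.1 = s) then a.2.2 else price A s := rfl
    by_cases hs : a.2.1 = s
    · exact ⟨a, List.mem_cons_self, hs, by simp [h1, hs]⟩
    · simp only [hs, decide_false, cond_false] at h1
      rw [h1] at h ⊢
      obtain ⟨e, he, h2⟩ := ih h
      exact ⟨e, List.mem_cons_of_mem _ he, h2⟩

theorem bestOffer_spec (n : ℕ) (A : List Sale) (l : List (List Bool)) :
    (bestOffer n A l).1 ≤ n ∧ (∀ s ∈ l, (bestOffer n A l).1 ≤ price A s) ∧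
      ((bestOffer n A l).1 < n → (bestOffer n A l).2 ∈ l ∧
        price A (bestOffer n A l).2 = (bestOffer n A l).1) := by
  induction l with
  | nil => simp [bestOffer]
  | cons s l ih =>
    obtain ⟨h1, h2, h3⟩ := ih
    have h : bestOffer n A (s :: l) = bif decide (price A s < (bestOffer n A l).1)
      then (price A s, s) else bestOffer n A l := rfl
    by_cases hs : price A s < (bestOffer n A l).1
    · simp only [hs, decide_true, cond_true] at h
      rw [h]
      refine ⟨by dsimp only; omega, ?_, by simp⟩
      intro s' hs'
      rcases List.mem_cons.1 hs' with rfl | hs'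
      · exact le_rfl
      · have := h2 s' hs'; dsimp only; omega
    · simp only [hs, decide_false, cond_false] at h
      rw [h]
      refine ⟨h1, ?_, fun hn => ⟨List.mem_cons_of_mem _ (h3 hn).1, (h3 hn).2⟩⟩
      intro s' hs'
      rcases List.mem_cons.1 hs' with rfl | hs'
      · omega
      · exact h2 s' hs'

/-- The invariant of the auction. -/
structure AuctionInv (bs : List Bidder) (st : List Sale × List Bidder) : Prop where
  perm : (st.1.map Prod.fst ++ st.2).Perm bs
  nodup : (st.1.map fun e => e.2.1).Nodup
  mem : ∀ e ∈ st.1, e.2.1 ∈ e.1.2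
  pos : ∀ e ∈ st.1, 1 ≤ e.2.2
  le : ∀ e ∈ st.1, e.2.2 ≤ bs.length
  cheap : ∀ e ∈ st.1, ∀ s ∈ e.1.2, e.2.2 ≤ price st.1 s + 1

/-- The sum of all prices. -/
def revenue (A : List Sale) : ℕ := (A.map fun e => e.2.2).sum

theorem price_filter {A : List Sale} {s s' : List Bool} (h : s' ≠ s) :
    price (A.filter fun e => !decide (e.2.1 = s)) s' = price A s' := by
  induction A with
  | nil => rfl
  | cons a A ih =>
    have h1 : ∀ A, price (a :: A) s' = bif decide (a.2.1 = s') then a.2.2 else price A s' :=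
      fun _ => rfl
    by_cases ha : a.2.1 = s
    · have h2 : a.2.1 ≠ s' := fun h' => h (h'.symm.trans ha)
      rw [List.filter_cons_of_neg (by simp [ha]), ih, h1]
      simp [h2]
    · rw [List.filter_cons_of_pos (by simp [ha]), h1, h1, ih]

/-- As items are sold at most once, the filter removes at most one sale, and an unsold item has
price 0. -/
theorem revenue_filter {A : List Sale} (hA : (A.map fun e => e.2.1).Nodup) (s : List Bool) :
    revenue A = revenue (A.filter fun e => !decide (e.2.1 = s)) + price A s := by
  induction A with
  | nil => rfl
  | cons a A ih =>
    rw [List.map_cons, List.nodup_cons] at hA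
    have h1 : price (a :: A) s = bif decide (a.2.1 = s) then a.2.2 else price A s := rfl
    have h2 : ∀ A, revenue (a :: A) = a.2.2 + revenue A := fun A => by simp [revenue]
    by_cases ha : a.2.1 = s
    · have h3 : A.filter (fun e => !decide (e.2.1 = s)) = A := by
        refine List.filter_eq_self.2 fun e he => ?_
        have : e.2.1 ≠ s := fun h => hA.1 (List.mem_map.2 ⟨e, he, h.trans ha.symm⟩)
        simp [this]
      rw [List.filter_cons_of_neg (by simp [ha]), h3, h1, h2]
      simp [ha, Nat.add_comm]
    · rw [List.filter_cons_of_pos (by simp [ha]), h2, h2, ih hA.2, h1]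
      simp [ha, Nat.add_assoc]

/-- Prices never fall, so nobody's earlier purchase becomes too expensive in comparison; the new
owner satisfies `cheap` because the item was a cheapest one. -/
theorem AuctionInv.sell {bs q : List Bidder} {A : List Sale} {b : Bidder}
    (h : AuctionInv bs (A, b :: q)) {s : List Bool} (hs : s ∈ b.2) (hlt : price A s < bs.length)
    (hmin : ∀ s' ∈ b.2, price A s ≤ price A s') :
    AuctionInv bs (sell A q b (price A s, s)) := by
  have hprice : ∀ s', price (MLETeaching.sell A q b (price A s, s)).1 s' =
      if s' = s then price A s + 1 else price A s' := by
    intro s'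
    change (bif decide (s = s') then price A s + 1 else
      price (A.filter fun e => !decide (e.2.1 = s)) s') = _
    by_cases h' : s' = s
    · simp [h']
    · simp [h', Ne.symm h', price_filter h']
  have hge : ∀ s', price A s' ≤ price (MLETeaching.sell A q b (price A s, s)).1 s' := by
    intro s'
    rw [hprice]
    split_ifs with h'
    · rw [h']; omega
    · exact le_rfl
  have hmem : ∀ {P : Sale → Prop}, P (b, s, price A s + 1) → (∀ e ∈ A, P e) →
      ∀ e ∈ (MLETeaching.sell A q b (price A s, s)).1, P e := by
    intro P h1 h2 e he
    rcases List.mem_cons.1 he with rfl | he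
    · exact h1
    · exact h2 e (List.mem_filter.1 he).1
  refine ⟨?_, ?_, hmem hs h.mem, hmem (Nat.le_add_left _ _) h.pos, hmem hlt h.le,
    hmem (fun s' hs' => ?_) fun e he s' hs' => (h.cheap e he s' hs').trans ?_⟩
  · refine List.Perm.trans ?_ h.perm
    simp only [MLETeaching.sell, List.map_cons, List.cons_append]
    refine List.Perm.trans ?_ List.perm_middle.symm
    refine List.Perm.cons _ ?_
    rw [← List.append_assoc, ← List.map_append]
    refine List.Perm.append_right _ (List.Perm.map _ ?_)
    refine List.perm_append_comm.trans ?_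
    exact List.filter_append_perm (fun e : Sale => decide (e.2.1 = s)) A
  · simp only [MLETeaching.sell, List.map_cons, List.nodup_cons]
    refine ⟨by simp, h.nodup.sublist (List.filter_sublist.map _)⟩
  · have := hmin s' hs'
    have := hge s'
    dsimp only; omega
  · exact Nat.add_le_add_right (hge s') 1

/-- A state in which the first bidder of the queue cannot buy. -/
def Stuck (n : ℕ) (st : List Sale × List Bidder) : Prop :=
  ∃ b q, st.2 = b :: q ∧ ∀ s ∈ b.2, n ≤ price st.1 s

/-- A sale replaces the old price of the item by that price plus one, whether or not it had an
owner. When no sale happens, `bestOffer` has found no acceptable price below the ceiling. -/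
theorem auctionStep_cases {bs : List Bidder} {st : List Sale × List Bidder}
    (h : AuctionInv bs st) : AuctionInv bs (auctionStep bs.length st) ∧
      ((auctionStep bs.length st = st ∧ (st.2 = [] ∨ Stuck bs.length st)) ∨
        revenue (auctionStep bs.length st).1 = revenue st.1 + 1) := by
  obtain ⟨A, _ | ⟨b, q⟩⟩ := st
  · exact ⟨h, Or.inl ⟨rfl, Or.inl rfl⟩⟩
  · obtain ⟨h1, h2, h3⟩ := bestOffer_spec bs.length A b.2
    have hstep : auctionStep bs.length (A, b :: q) =
      bif decide ((bestOffer bs.length A b.2).1 < bs.length) then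
        sell A q b (bestOffer bs.length A b.2) else (A, b :: q) := rfl
    by_cases hlt : (bestOffer bs.length A b.2).1 < bs.length
    · obtain ⟨h4, h5⟩ := h3 hlt
      simp only [hlt, decide_true, cond_true] at hstep
      rw [hstep]
      rw [← h5] at h2 hlt
      have h6 : bestOffer bs.length A b.2 = (price A (bestOffer bs.length A b.2).2,
        (bestOffer bs.length A b.2).2) := by rw [h5]
      rw [h6]
      refine ⟨h.sell h4 hlt h2, Or.inr ?_⟩
      rw [revenue_filter h.nodup (bestOffer bs.length A b.2).2]
      simp only [sell, revenue, List.map_cons, List.sum_cons]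
      omega
    · simp only [hlt, decide_false, cond_false] at hstep
      rw [hstep]
      refine ⟨h, Or.inl ⟨rfl, Or.inr ⟨b, q, rfl, fun s hs => ?_⟩⟩⟩
      have := h2 s hs
      dsimp only; omega

theorem AuctionInv.init (bs : List Bidder) : AuctionInv bs ([], bs) :=
  ⟨by simp, by simp, by simp, by simp, by simp, by simp⟩

theorem AuctionInv.length_add {bs : List Bidder} {st : List Sale × List Bidder}
    (h : AuctionInv bs st) : st.1.length + st.2.length = bs.length := by
  simpa using h.perm.length_eq

/-- States with an empty queue and stuck states are fixed points of the step; before one is reached,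
every step contributes one to the revenue. -/
theorem auction_run (bs : List Bidder) (l : List Unit) :
    AuctionInv bs (l.foldl (fun st _ => auctionStep bs.length st) ([], bs)) ∧
    ((l.foldl (fun st _ => auctionStep bs.length st) ([], bs)).2 = [] ∨
      Stuck bs.length (l.foldl (fun st _ => auctionStep bs.length st) ([], bs)) ∨
      l.length ≤ revenue (l.foldl (fun st _ => auctionStep bs.length st) ([], bs)).1) := by
  induction l using List.reverseRecOn with
  | nil => exact ⟨.init bs, Or.inr (Or.inr (Nat.zero_le _))⟩
  | append_singleton l a ih =>
    rw [List.foldl_append, List.foldl_cons, List.foldl_nil]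
    generalize l.foldl (fun st _ => auctionStep bs.length st) ([], bs) = st at ih ⊢
    obtain ⟨h1, h2⟩ := ih
    obtain ⟨h3, h4⟩ := auctionStep_cases h1
    refine ⟨h3, ?_⟩
    rcases h4 with ⟨h4, h5⟩ | h4
    · rw [h4]
      tauto
    · rcases h2 with h2 | ⟨b, q, h2, h5⟩ | h2
      · left
        simp [auctionStep, h2]
      · right; left
        obtain ⟨A, Q⟩ := st
        obtain rfl : Q = b :: q := h2
        have hstep : auctionStep bs.length (A, b :: q) =
          bif decide ((bestOffer bs.length A b.2).1 < bs.length) then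
            sell A q b (bestOffer bs.length A b.2) else (A, b :: q) := rfl
        obtain ⟨-, -, h6⟩ := bestOffer_spec bs.length A b.2
        have h7 : ¬ (bestOffer bs.length A b.2).1 < bs.length := fun hlt => by
          obtain ⟨h8, h9⟩ := h6 hlt
          have := h5 _ h8
          dsimp only at this
          omega
        simp only [h7, decide_false, cond_false] at hstep
        rw [hstep]
        exact ⟨b, q, rfl, h5⟩
      · right; right
        rw [List.length_append, h4]
        simpa using h2

theorem AuctionInv.revenue_le {bs : List Bidder} {st : List Sale × List Bidder}
    (h : AuctionInv bs st) : revenue st.1 ≤ bs.length * bs.length := by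
  refine (List.sum_le_card_nsmul (st.1.map fun e => e.2.2) bs.length ?_).trans ?_
  · intro x hx
    obtain ⟨e, he, rfl⟩ := List.mem_map.1 hx
    exact h.le e he
  · have := h.length_add
    rw [List.length_map, smul_eq_mul]
    exact Nat.mul_le_mul_right _ (by omega)

/-- The auction makes one step more than the largest possible revenue, so it must have reached a
fixed point. -/
theorem auction_spec (bs : List Bidder) : AuctionInv bs (auction bs) ∧
    ((auction bs).2 = [] ∨ Stuck bs.length (auction bs)) := by
  obtain ⟨h1, h2⟩ := auction_run bs (List.replicate (bs.length * bs.length + 1) ())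
  refine ⟨h1, ?_⟩
  have := h1.revenue_le
  rcases h2 with h2 | h2 | h2
  · exact Or.inl h2
  · exact Or.inr h2
  · rw [List.length_replicate] at h2
    omega

/-- If the auction is stuck then the bidders do not have distinct representatives. -/
theorem AuctionInv.false_of_stuck {bs : List Bidder} {st : List Sale × List Bidder}
    (h : AuctionInv bs st) (hbs : bs.Nodup) (hst : Stuck bs.length st)
    (f : Bidder → List Bool) (hf : ∀ b ∈ bs, f b ∈ b.2) (hinj : Set.InjOn f {b | b ∈ bs}) :
    False := by
  obtain ⟨A, Q⟩ := st
  obtain ⟨b, q, rfl : Q = b :: q, hb⟩ := hst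
  have hlen : A.length + (q.length + 1) = bs.length := h.length_add
  -- The stuck bidder owns nothing, so there are fewer sales than price levels `1, …, n`, and some
  -- level `j` is unused.
  obtain ⟨j, hj, hjA⟩ : ∃ j ∈ Finset.Icc 1 bs.length, ∀ e ∈ A, e.2.2 ≠ j := by
    by_contra! hcon
    have h1 : Finset.Icc 1 bs.length ⊆ (A.map fun e => e.2.2).toFinset := fun j hj => by
      obtain ⟨e, he, h2⟩ := hcon j hj
      exact List.mem_toFinset.2 (List.mem_map.2 ⟨e, he, h2⟩)
    have h2 := (Finset.card_le_card h1).trans (List.toFinset_card_le _)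
    rw [Nat.card_Icc, List.length_map] at h2
    omega
  rw [Finset.mem_Icc] at hj
  let S := A.filter fun e => decide (j < e.2.2)
  -- The Hall violator: the stuck bidder together with the owners of the items dearer than `j`, one
  -- bidder more than there are such items.
  let R := b :: S.map Prod.fst
  have hnodup : (A.map Prod.fst ++ b :: q).Nodup := h.perm.nodup_iff.2 hbs
  have hR : R.Nodup := by
    have h1 := (List.perm_middle.nodup_iff.1 hnodup)
    rw [List.nodup_cons] at h1
    refine List.nodup_cons.2 ⟨fun h2 => h1.1 ?_, ?_⟩
    · obtain ⟨e, he, rfl⟩ := List.mem_map.1 h2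
      exact List.mem_append_left _ (List.mem_map_of_mem (List.mem_filter.1 he).1)
    · exact (List.nodup_append.1 hnodup).1.sublist (List.filter_sublist.map _)
  have hRbs : ∀ b' ∈ R, b' ∈ bs := by
    intro b' hb'
    refine h.perm.subset ?_
    rcases List.mem_cons.1 hb' with rfl | hb'
    · simp
    · obtain ⟨e, he, rfl⟩ := List.mem_map.1 hb'
      exact List.mem_append_left _ (List.mem_map_of_mem (List.mem_filter.1 he).1)
  -- Everything acceptable to `R` costs at least `j`: for `b` by being stuck, for an owner by
  -- `cheap`. As no sale has price exactly `j`, it costs more than `j` and lies in `S`.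
  have hsub : ∀ b' ∈ R, ∀ s ∈ b'.2, s ∈ S.map fun e => e.2.1 := by
    intro b' hb' s hs
    have h1 : j ≤ price A s := by
      rcases List.mem_cons.1 hb' with rfl | hb'
      · have := hb s hs
        dsimp only at this
        omega
      · obtain ⟨e, he, rfl⟩ := List.mem_map.1 hb'
        obtain ⟨he, hje⟩ := List.mem_filter.1 he
        have := h.cheap e he s hs
        rw [decide_eq_true_eq] at hje
        dsimp only at this
        omega
    obtain ⟨e, he, rfl, h3⟩ := exists_of_price_pos (A := A) (s := s) (by omega)
    have := hjA e he
    exact List.mem_map.2 ⟨e, List.mem_filter.2 ⟨he, by rw [decide_eq_true_eq]; omega⟩, rfl⟩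
  have h1 : (R.map f).Nodup := hR.map_on fun x hx y hy hxy => hinj (hRbs x hx) (hRbs y hy) hxy
  have h2 : R.map f ⊆ S.map fun e => e.2.1 := fun s hs => by
    obtain ⟨b', hb', rfl⟩ := List.mem_map.1 hs
    exact hsub b' hb' _ (hf b' (hRbs b' hb'))
  have h3 := (h1.subperm h2).length_le
  simp [R] at h3

/-! #### Running time -/

namespace PT

variable {ι : Type*} [Enc ι]

@[fun_prop] theorem price {A : ι → List Sale} {s : ι → List Bool} (hA : PT A) (hs : PT s) :
    PT (fun i => price (A i) (s i)) := by
  have hs' : PT (fun x : ι × Sale × ℕ => s x.1) := hs.comp (.fst .id)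
  refine foldr_of_max (f := fun i e r => bif decide (e.2.1 = s i) then e.2.2 else r)
    (by fun_prop) (const 0) hA (PolyBdd.of_PT hA) fun i r e he => ?_
  have h1 := esize_le_of_mem he
  have h2 := esize_snd_lt e
  have h3 := esize_snd_lt e.2
  cases decide (e.2.1 = s i)
  · exact le_max_left ..
  · simp only [cond_true]
    omega

@[fun_prop] theorem bestOffer {n : ι → ℕ} {A : ι → List Sale} {l : ι → List (List Bool)}
    (hn : PT n) (hA : PT A) (hl : PT l) : PT (fun i => bestOffer (n i) (A i) (l i)) := by
  have hA' : PT (fun x : ι × List Bool × ℕ × List Bool => A x.1) := hA.comp (.fst .id)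
  have hp : PT (fun x : ι × List Bool => MLETeaching.price (A x.1) x.2) := by fun_prop
  obtain ⟨s, hs, h⟩ := polyBdd_mem (f := fun i s => MLETeaching.price (A i) s) hl hp
  refine foldr_of_max
    (f := fun i s r => bif decide (MLETeaching.price (A i) s < r.1)
      then (MLETeaching.price (A i) s, s) else r) (b := fun i => (n i, []))
    (by fun_prop) (by fun_prop) hl (((PolyBdd.const 1).add hs).add (PolyBdd.of_PT hl))
    fun i r a ha => ?_
  have h1 := esize_le_of_mem ha
  have h2 := h i a ha
  cases decide (MLETeaching.price (A i) a < r.1)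
  · exact le_max_left ..
  · simp only [cond_true, esize_pair]
    omega

@[fun_prop] theorem sell {A : ι → List Sale} {q : ι → List Bidder} {b : ι → Bidder}
    {r : ι → ℕ × List Bool} (hA : PT A) (hq : PT q) (hb : PT b) (hr : PT r) :
    PT (fun i => sell (A i) (q i) (b i) (r i)) := by
  unfold MLETeaching.sell
  fun_prop

@[fun_prop] theorem auctionStep {n : ι → ℕ} {st : ι → List Sale × List Bidder}
    (hn : PT n) (hst : PT st) : PT (fun i => auctionStep (n i) (st i)) := by
  unfold MLETeaching.auctionStep
  fun_prop

-- The sizes of the states come from the invariant: bidders and items already occur in `bs`, there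
-- are at most `bs.length` of each in a state, and prices are at most `bs.length`.
@[fun_prop] theorem auction {bs : ι → List Bidder} (hbs : PT bs) :
    PT (fun i => auction (bs i)) := by
  unfold MLETeaching.auction
  have hn : PT (fun x : ι × (List Sale × List Bidder) × Unit => (bs x.1).length) := by fun_prop
  have hb := PolyBdd.of_PT hbs
  refine foldl (s := fun i => 1 + (1 + esize (bs i) * (1 + (2 + 4 * esize (bs i)))) +
      (1 + esize (bs i) * (1 + esize (bs i))))
    (f := fun i st _ => MLETeaching.auctionStep (bs i).length st) (by fun_prop)
    (by fun_prop) (by fun_prop)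
    (((PolyBdd.const 1).add ((PolyBdd.const 1).add (hb.mul ((PolyBdd.const 1).add
      ((PolyBdd.const 2).add ((PolyBdd.const 4).mul hb)))))).add
      ((PolyBdd.const 1).add (hb.mul ((PolyBdd.const 1).add hb)))) fun i l₁ l₂ _ => ?_
  have h := (auction_run (bs i) l₁).1
  generalize l₁.foldl (fun st _ => MLETeaching.auctionStep (bs i).length st) ([], bs i) = st at h
  obtain ⟨A, q⟩ := st
  have h1 : A.length + q.length = _ := h.length_add
  have h2 := length_lt_esize (bs i)
  have hm : ∀ b ∈ A.map Prod.fst ++ q, esize b ≤ esize (bs i) := fun b hb =>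
    esize_le_of_mem (h.perm.subset hb)
  rw [esize_pair]
  refine Nat.add_le_add (Nat.add_le_add_left ?_ _) ?_
  · refine (esize_list_le (k := 2 + 4 * esize (bs i)) fun e he => ?_).trans
      (Nat.add_le_add_left (Nat.mul_le_mul_right _ (by omega)) _)
    have h3 := hm e.1 (List.mem_append_left _ (List.mem_map_of_mem he))
    have h4 := esize_le_of_mem (h.mem e he)
    have h5 := esize_snd_lt e.1
    have h6 := h.le e he
    obtain ⟨b, s, p⟩ := e
    dsimp only at *
    rw [esize_pair b (s, p), esize_pair s p, esize_nat]
    omega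
  · exact (esize_list_le fun b hb => hm b (List.mem_append_right _ hb)).trans
      (Nat.add_le_add_left (Nat.mul_le_mul_right _ (by omega)) _)

end PT
/-! ### Minimum-order matchings -/

/-- The number of elements of a set given by its 0-1-vector. -/
def weight (v : List Bool) : ℕ := (v.filter fun b => b).length

/-- Subsets of `row` with at most `d` elements: all of them, or at least `k` of them. -/
def subsets (k d : ℕ) (row : List Bool) : List (List Bool) :=
  row.foldr (fun b r => r.map (fun v => false :: v) ++
    bif b && decide (r.length < k) then
      (r.filter fun v => decide (weight v < d)).map fun v => true :: v else []) [[]]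

/-- Nonempty subsets of `row` with at most `d` elements. -/
def candidates (k d : ℕ) (row : List Bool) : List (List Bool) :=
  (subsets k d row).filter fun v => decide (0 < weight v)

/-- The rows as numbered bidders. -/
def bidders (d : ℕ) (rows : List (List Bool)) : List Bidder :=
  (List.range rows.length).zip (rows.map (candidates (rows.length + 1) d))

/-- The item sold to the `i`-th bidder. -/
def owned (A : List Sale) (i : ℕ) : List Bool :=
  A.foldr (fun e r => bif decide (e.1.1 = i) then e.2.1 else r) []

/-- The smallest `d ≤ m` with a saturating matching of order at most `d`,
and such a matching. -/
def minMatching (m : ℕ) (rows : List (List Bool)) : Bool × ℕ × List (List Bool) :=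
  (List.range (m + 1)).foldr (fun d r =>
    bif (auction (bidders d rows)).2.isEmpty then
      (true, d, (List.range rows.length).map (owned (auction (bidders d rows)).1))
    else r) (false, 0, [])

/-! #### Enumeration of subsets -/

@[simp] theorem weight_nil : weight [] = 0 := rfl
@[simp] theorem weight_cons_true (v : List Bool) : weight (true :: v) = weight v + 1 := rfl
@[simp] theorem weight_cons_false (v : List Bool) : weight (false :: v) = weight v := rfl

theorem subsets_cons (k d : ℕ) (b : Bool) (row : List Bool) :
    subsets k d (b :: row) = (subsets k d row).map (fun v => false :: v) ++
      bif b && decide ((subsets k d row).length < k) then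
        ((subsets k d row).filter fun v => decide (weight v < d)).map fun v => true :: v
      else [] := rfl

theorem mem_subsets_cons {k d : ℕ} {b : Bool} {row v : List Bool} :
    v ∈ subsets k d (b :: row) ↔ (∃ w ∈ subsets k d row, false :: w = v) ∨
      ((b = true ∧ (subsets k d row).length < k) ∧
        ∃ w ∈ subsets k d row, weight w < d ∧ true :: w = v) := by
  rw [subsets_cons, List.mem_append, List.mem_map, Bool.cond_eq_ite]
  split_ifs with h
  · rw [Bool.and_eq_true, decide_eq_true_eq] at h
    simp [h, and_assoc]
  · rw [Bool.and_eq_true, decide_eq_true_eq] at h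
    simp [h]

theorem subsets_sound {k d : ℕ} {row v : List Bool} (h : v ∈ subsets k d row) :
    List.Forall₂ (fun a b => a = true → b = true) v row ∧ weight v ≤ d := by
  induction row generalizing v with
  | nil =>
    obtain rfl : v = [] := by simpa [subsets] using h
    simp
  | cons b row ih =>
    rcases mem_subsets_cons.1 h with ⟨w, hw, rfl⟩ | ⟨⟨hb, -⟩, w, hw, hd, rfl⟩
    · exact ⟨.cons (by simp) (ih hw).1, (ih hw).2⟩
    · exact ⟨.cons (fun _ => hb) (ih hw).1, hd⟩

/-- Prepending a column never shortens the list, so once `k` vectors are present they remain so;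
until then nothing is omitted. -/
theorem subsets_complete (k d : ℕ) (row : List Bool) : k ≤ (subsets k d row).length ∨
    ∀ v, List.Forall₂ (fun a b => a = true → b = true) v row → weight v ≤ d →
      v ∈ subsets k d row := by
  induction row with
  | nil =>
    right
    intro v hv _
    cases hv
    simp [subsets]
  | cons b row ih =>
    rcases Nat.lt_or_ge (subsets k d row).length k with hlt | hge
    · right
      have ih := ih.resolve_left (by omega)
      intro v hv hd
      cases hv with
      | @cons a _ w _ h1 h2 =>
        cases a
        · exact mem_subsets_cons.2 (Or.inl ⟨w, ih w h2 hd, rfl⟩)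
        · rw [weight_cons_true] at hd
          exact mem_subsets_cons.2 (Or.inr ⟨⟨h1 rfl, hlt⟩, w, ih w h2 (by omega), hd, rfl⟩)
    · left
      rw [subsets_cons, List.length_append, List.length_map]
      omega

theorem subsets_nodup (k d : ℕ) (row : List Bool) : (subsets k d row).Nodup := by
  induction row with
  | nil => simp [subsets]
  | cons b row ih =>
    have hinj : ∀ b : Bool, Function.Injective fun v => b :: v := fun b v w h => by simpa using h
    rw [subsets_cons, Bool.cond_eq_ite]
    split_ifs with h
    · refine List.nodup_append.2 ⟨ih.map (hinj _), (ih.filter _).map (hinj _), ?_⟩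
      intro a ha b hb
      obtain ⟨v, -, rfl⟩ := List.mem_map.1 ha
      obtain ⟨w, -, rfl⟩ := List.mem_map.1 hb
      simp
    · simpa using ih.map (hinj _)

/-- The list can at most double, and only while it is shorter than `k`. This cap keeps the
enumeration polynomial. -/
theorem length_subsets_le (k d : ℕ) (row : List Bool) : (subsets k d row).length ≤ 2 * k + 1 := by
  induction row with
  | nil => simp [subsets]
  | cons b row ih =>
    rw [subsets_cons, Bool.cond_eq_ite, List.length_append, List.length_map]
    split_ifs with h
    · rw [Bool.and_eq_true, decide_eq_true_eq] at h
      have := List.length_filter_le (fun v => decide (weight v < d)) (subsets k d row)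
      rw [List.length_map]
      omega
    · simpa using ih

/-- The cutoff is `k + 1` because discarding the zero vector, the only one of weight 0, may cost one
element. -/
theorem candidates_complete (k d : ℕ) (row : List Bool) :
    k ≤ (candidates (k + 1) d row).length ∨
      ∀ v, List.Forall₂ (fun a b => a = true → b = true) v row → weight v ≤ d → 0 < weight v →
        v ∈ candidates (k + 1) d row := by
  rcases subsets_complete (k + 1) d row with h | h
  · left
    have h1 : (candidates (k + 1) d row).length +
        ((subsets (k + 1) d row).filter fun v => !decide (0 < weight v)).length =
        (subsets (k + 1) d row).length :=
      List.length_eq_length_filter_add _ |>.symm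
    have h2 : ((subsets (k + 1) d row).filter fun v => !decide (0 < weight v)).length ≤ 1 := by
      have h3 := (subsets_nodup (k + 1) d row).filter fun v => !decide (0 < weight v)
      have h4 : ((subsets (k + 1) d row).filter fun v => !decide (0 < weight v)) ⊆
          [List.replicate row.length false] := fun v hv => by
        obtain ⟨hv, hw⟩ := List.mem_filter.1 hv
        have h5 := (subsets_sound hv).1.length_eq
        rw [List.mem_singleton, List.eq_replicate_iff]
        refine ⟨h5, fun b hb => ?_⟩
        have h6 : weight v = 0 := by simpa using hw
        cases b
        · rfl
        · exact absurd (List.mem_filter.2 ⟨hb, rfl⟩ : true ∈ v.filter fun b => b)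
            (by rw [List.length_eq_zero_iff.1 h6]; simp)
      exact (h3.subperm h4).length_le
    omega
  · right
    intro v h1 h2 h3
    exact List.mem_filter.2 ⟨h v h1 h2, by simpa using h3⟩

/-! #### 0-1-vectors of sets -/

open Classical in
/-- The 0-1-vector of a set. -/
noncomputable def charVec {V : Type*} (s : List V) (p : V → Prop) : List Bool :=
  s.map fun w => decide (p w)

section charVec

variable {V : Type*} {s : List V}

theorem charVec_inj {p q : V → Prop} (hs : ∀ w, w ∈ s) (h : charVec s p = charVec s q) :
    p = q := by
  ext w
  simpa using List.map_inj_left.1 h w (hs w)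

theorem exists_eq_charVec (hs : s.Nodup) {v : List Bool} (hv : v.length = s.length) :
    ∃ p, v = charVec s p := by
  classical
  induction s generalizing v with
  | nil => exact ⟨fun _ => True, by simpa [charVec] using hv⟩
  | cons w s ih =>
    obtain _ | ⟨b, v⟩ := v
    · simp at hv
    · rw [List.nodup_cons] at hs
      obtain ⟨p, rfl⟩ := ih hs.2 (v := v) (by simpa using hv)
      refine ⟨fun x => if x = w then b = true else p x, ?_⟩
      simp only [charVec, List.map_cons, if_true, Bool.decide_eq_true, List.cons.injEq, true_and]
      refine List.map_congr_left fun x hx => ?_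
      have : x ≠ w := fun h => hs.1 (h ▸ hx)
      simp [this]

theorem forall₂_charVec {p q : V → Prop} (hs : ∀ w, w ∈ s) :
    List.Forall₂ (fun a b => a = true → b = true) (charVec s p) (charVec s q) ↔
      ∀ w, p w → q w := by
  simp [charVec, List.forall₂_map_left_iff, List.forall₂_map_right_iff, List.forall₂_same, hs]

theorem weight_charVec (hs : s.Nodup) (hs' : ∀ w, w ∈ s) (B : Finset V) :
    weight (charVec s fun w => w ∈ B) = B.card := by
  classical
  have h1 : weight (charVec s fun w => w ∈ B) = (s.filter fun w => decide (w ∈ B)).length := by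
    simp only [weight, charVec, List.filter_map, List.length_map]
    congr 2
    funext w
    simp
  rw [h1, ← List.toFinset_card_of_nodup (hs.filter _)]
  congr 1
  ext w
  simp [hs']

end charVec

/-! #### Correctness -/

theorem owned_eq_of_mem {A : List Sale} (hA : (A.map fun e => e.1.1).Nodup) {e : Sale}
    (he : e ∈ A) : owned A e.1.1 = e.2.1 := by
  induction A with
  | nil => simp at he
  | cons a A ih =>
    rw [List.map_cons, List.nodup_cons] at hA
    change (bif decide (a.1.1 = e.1.1) then a.2.1 else owned A e.1.1) = _
    rcases List.mem_cons.1 he with rfl | he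
    · simp
    · have : a.1.1 ≠ e.1.1 := fun h => hA.1 (h ▸ List.mem_map_of_mem he)
      simp [this, ih hA.2 he]

/-- In a right fold the head of the list decides last, so the smallest index satisfying `p` wins. -/
theorem foldr_first {α : Type*} (p : ℕ → Bool) (g : ℕ → α) (b : α) (m : ℕ) :
    (∃ d ≤ m, p d = true ∧ (∀ d' < d, p d' = false) ∧
      (List.range (m + 1)).foldr (fun d r => bif p d then g d else r) b = g d) ∨
    ((∀ d ≤ m, p d = false) ∧
      (List.range (m + 1)).foldr (fun d r => bif p d then g d else r) b = b) := by
  have h : ∀ l : List ℕ, l.foldr (fun d r => bif p d then g d else r) b =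
      ((l.find? p).map g).getD b := by
    intro l
    induction l with
    | nil => rfl
    | cons d l ih =>
      rw [List.foldr_cons, List.find?_cons]
      cases p d
      · simpa using ih
      · rfl
  rw [h]
  cases hf : (List.range (m + 1)).find? p with
  | none =>
    right
    rw [List.find?_eq_none] at hf
    exact ⟨fun d hd => by simpa using hf d (by simp; omega), rfl⟩
  | some d =>
    left
    rw [List.find?_range_eq_some] at hf
    obtain ⟨h1, h2, h3⟩ := hf
    rw [List.mem_range] at h2
    exact ⟨d, by omega, h1, fun d' hd' => by simpa using h3 d' hd', rfl⟩

section spec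

variable {n : ℕ} {V : Type*} (G : BipGraph (Fin n) V) (s : List V)

/-- The rows of the adjacency matrix. -/
noncomputable def adjRows : List (List Bool) := (List.finRange n).map fun v => charVec s (G v)

@[simp] theorem length_adjRows : (adjRows G s).length = n := by simp [adjRows]

theorem bidders_adjRows (d : ℕ) : bidders d (adjRows G s) =
    (List.finRange n).map fun v => (v.1, candidates (n + 1) d (charVec s (G v))) := by
  rw [bidders, length_adjRows, adjRows, ← List.map_coe_finRange_eq_range, List.map_map,
    List.zip_map']
  rfl

/-- The numbers keep vertices with equal neighbourhoods apart. -/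
theorem nodup_bidders (d : ℕ) : (bidders d (adjRows G s)).Nodup := by
  rw [bidders_adjRows]
  refine (List.nodup_finRange n).map fun v w h => ?_
  exact Fin.ext (congrArg Prod.fst h)

variable {G s}

/-- With an empty queue the bidders are exactly the owners, and distinct items give injectivity:
equal items mean equal sales, hence equal names. -/
theorem exists_of_auction (hs : s.Nodup) (hs' : ∀ w, w ∈ s) {d : ℕ}
    (h : (auction (bidders d (adjRows G s))).2.isEmpty = true) :
    ∃ M : Fin n → {B : Finset V // B.Nonempty}, IsSaturatingMatching G.plus M ∧
      order sizeOfSet M ≤ d ∧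
      (List.range (adjRows G s).length).map (owned (auction (bidders d (adjRows G s))).1) =
        (List.finRange n).map fun v => charVec s fun w => w ∈ (M v).1 := by
  classical
  obtain ⟨hinv, -⟩ := auction_spec (bidders d (adjRows G s))
  generalize auction (bidders d (adjRows G s)) = st at h hinv
  obtain ⟨A, q⟩ := st
  obtain rfl : q = [] := by simpa using h
  have hperm : (A.map Prod.fst).Perm (bidders d (adjRows G s)) := by simpa using hinv.perm
  have hnames : (A.map fun e => e.1.1).Nodup := by
    have h1 := hperm.map Prod.fst
    rw [bidders_adjRows, List.map_map, List.map_map] at h1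
    refine h1.nodup_iff.2 ((List.nodup_finRange n).map fun v w h => Fin.ext h)
  have hex : ∀ v : Fin n, ∃ e ∈ A,
      e.1 = (v.1, candidates (n + 1) d (charVec s (G v))) := fun v => by
    have h1 : (v.1, candidates (n + 1) d (charVec s (G v))) ∈ bidders d (adjRows G s) := by
      rw [bidders_adjRows]
      exact List.mem_map.2 ⟨v, List.mem_finRange v, rfl⟩
    obtain ⟨e, he, h2⟩ := List.mem_map.1 (hperm.symm.subset h1)
    exact ⟨e, he, h2⟩
  choose e heA he using hex
  have hcand : ∀ v, (e v).2.1 ∈ candidates (n + 1) d (charVec s (G v)) := fun v => by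
    have := hinv.mem (e v) (heA v)
    rwa [he v] at this
  have hB : ∀ v, ∃ B : Finset V, (e v).2.1 = charVec s fun w => w ∈ B := fun v => by
    have h1 := (subsets_sound (List.mem_filter.1 (hcand v)).1).1.length_eq
    obtain ⟨p, hp⟩ := exists_eq_charVec hs (v := (e v).2.1) (by simpa [charVec] using h1)
    exact ⟨s.toFinset.filter p, by simp [hp, hs']⟩
  choose B hB using hB
  have hprop : ∀ v, (∀ w ∈ B v, G v w) ∧ (B v).card ≤ d ∧ (B v).Nonempty := fun v => by
    have h1 := hcand v
    rw [candidates, List.mem_filter, hB v] at h1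
    obtain ⟨h2, h3⟩ := h1
    obtain ⟨h4, h5⟩ := subsets_sound h2
    rw [decide_eq_true_eq, weight_charVec hs hs', Finset.card_pos] at h3
    rw [weight_charVec hs hs'] at h5
    exact ⟨(forall₂_charVec hs').1 h4, h5, h3⟩
  refine ⟨fun v => ⟨B v, (hprop v).2.2⟩, ⟨fun v w hvw => ?_, fun v => (hprop v).1⟩,
    Finset.sup_le fun v _ => (hprop v).2.1, ?_⟩
  · have h1 : (e v).2.1 = (e w).2.1 := by
      rw [hB, hB, Subtype.mk.inj hvw]
    have h2 := List.inj_on_of_nodup_map hinv.nodup (heA v) (heA w) h1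
    have h3 := congrArg (fun x : Sale => x.1.1) h2
    simp only [he] at h3
    exact Fin.ext h3
  · rw [length_adjRows, ← List.map_coe_finRange_eq_range, List.map_map]
    refine List.map_congr_left fun v _ => ?_
    have h1 := owned_eq_of_mem hnames (heA v)
    rw [he v] at h1
    rw [Function.comp_apply, h1, hB v]

/-- The truncated families still satisfy Hall's condition, so they have distinct representatives and
the auction cannot be stuck. These representatives need not be the sets of `M`. -/
theorem auction_of_exists (hs : s.Nodup) (hs' : ∀ w, w ∈ s) {d : ℕ}
    {M : Fin n → {B : Finset V // B.Nonempty}} (hM : IsSaturatingMatching G.plus M)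
    (hd : order sizeOfSet M ≤ d) :
    (auction (bidders d (adjRows G s))).2.isEmpty = true := by
  classical
  obtain ⟨hinv, h | h⟩ := auction_spec (bidders d (adjRows G s))
  · simp [h]
  exfalso
  let t : Fin n → Finset (List Bool) := fun v =>
    (candidates (n + 1) d (charVec s (G v))).toFinset
  obtain ⟨f, hf, hft⟩ := (Finset.all_card_le_biUnion_card_iff_exists_injective t).1 fun R => by
    -- One family with `n` candidates outweighs any `R`. If there is none in `R`, all its families
    -- are complete and contain the sets assigned by `M`.
    by_cases hR : ∃ v ∈ R, n ≤ (candidates (n + 1) d (charVec s (G v))).length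
    · obtain ⟨v, hv, h1⟩ := hR
      calc R.card ≤ n := by simpa using R.card_le_univ
        _ ≤ (t v).card := by
          have h2 : (candidates (n + 1) d (charVec s (G v))).Nodup :=
            (subsets_nodup _ _ _).filter _
          rwa [← List.toFinset_card_of_nodup h2] at h1
        _ ≤ _ := Finset.card_le_card (Finset.subset_biUnion_of_mem t hv)
    · push Not at hR
      refine Finset.card_le_card_of_injOn (fun v => charVec s fun w => w ∈ (M v).1)
        (fun v hv => ?_) fun v _ w _ h1 => hM.1 (Subtype.ext (Finset.ext fun x =>
          iff_of_eq (congrFun (charVec_inj hs' h1) x)))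
      have h1 := (candidates_complete n d (charVec s (G v))).resolve_left (hR v hv).not_ge
      refine Finset.mem_coe.2 (Finset.mem_biUnion.2 ⟨v, hv, List.mem_toFinset.2 (h1 _ ?_ ?_ ?_)⟩)
      · exact (forall₂_charVec hs').2 (hM.2 v)
      · rw [weight_charVec hs hs']
        exact (Finset.le_sup (f := fun v => sizeOfSet (M v)) (Finset.mem_univ v)).trans hd
      · rw [weight_charVec hs hs']
        exact (M v).2.card_pos
  have hmem : ∀ b ∈ bidders d (adjRows G s), ∃ v : Fin n,
      b = (v.1, candidates (n + 1) d (charVec s (G v))) := fun b hb => by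
    rw [bidders_adjRows] at hb
    obtain ⟨v, -, rfl⟩ := List.mem_map.1 hb
    exact ⟨v, rfl⟩
  have hlt : ∀ v : Fin n, v.1 < n := fun v => v.2
  refine hinv.false_of_stuck (nodup_bidders G s d) h
    (fun b => if h : b.1 < n then f ⟨b.1, h⟩ else []) (fun b hb => ?_) fun b hb c hc hbc => ?_
  · obtain ⟨v, rfl⟩ := hmem b hb
    simpa [t] using hft v
  · obtain ⟨v, rfl⟩ := hmem b hb
    obtain ⟨w, rfl⟩ := hmem c hc
    have : v = w := hf (by simpa using hbc)
    rw [this]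

theorem minMatching_spec (hs : s.Nodup) (hs' : ∀ w, w ∈ s) :
    (∃ M : Fin n → {B : Finset V // B.Nonempty}, IsMinSaturatingMatching G.plus sizeOfSet M ∧
      minMatching s.length (adjRows G s) = (true, order sizeOfSet M,
        (List.finRange n).map fun v => charVec s fun w => w ∈ (M v).1)) ∨
    ((¬ ∃ M, IsSaturatingMatching G.plus M) ∧
      minMatching s.length (adjRows G s) = (false, 0, [])) := by
  classical
  -- No order exceeds the number of columns, so failure for all `d` up to it excludes every
  -- matching.
  have hle : ∀ M : Fin n → {B : Finset V // B.Nonempty}, order sizeOfSet M ≤ s.length :=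
    fun M => Finset.sup_le fun v _ => by
      rw [← List.toFinset_card_of_nodup hs]
      exact Finset.card_le_card fun w _ => List.mem_toFinset.2 (hs' w)
  rcases foldr_first (fun d => (auction (bidders d (adjRows G s))).2.isEmpty)
    (fun d => (true, d, (List.range (adjRows G s).length).map
      (owned (auction (bidders d (adjRows G s))).1))) (false, 0, []) s.length with
    ⟨d, -, h1, h2, h3⟩ | ⟨h1, h2⟩
  · left
    obtain ⟨M, hM, hMd, h4⟩ := exists_of_auction hs hs' h1
    have hmin : ∀ M', IsSaturatingMatching G.plus M' → d ≤ order sizeOfSet M' := by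
      intro M' hM'
      by_contra! hlt
      have := auction_of_exists hs hs' hM' le_rfl
      rw [h2 _ hlt] at this
      cases this
    have hd : order sizeOfSet M = d := hMd.antisymm (hmin M hM)
    exact ⟨M, ⟨hM, fun M' hM' => hd.trans_le (hmin M' hM')⟩, by rw [hd, ← h4]; exact h3⟩
  · right
    refine ⟨fun ⟨M, hM⟩ => ?_, h2⟩
    have := auction_of_exists hs hs' hM le_rfl
    rw [h1 _ (hle M)] at this
    cases this

end spec

/-! #### Running time -/

namespace PT

variable {ι : Type*} [Enc ι]

@[fun_prop] theorem weight {v : ι → List Bool} (hv : PT v) : PT (fun i => weight (v i)) := by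
  unfold MLETeaching.weight
  fun_prop

@[fun_prop] theorem subsets {k d : ι → ℕ} {row : ι → List Bool} (hk : PT k) (hd : PT d)
    (hrow : PT row) : PT (fun i => subsets (k i) (d i) (row i)) := by
  have hk' : PT (fun x : ι × Bool × List (List Bool) => k x.1) := hk.comp (.fst .id)
  have hd' : PT (fun x : (ι × Bool × List (List Bool)) × List Bool => d x.1.1) :=
    hd.comp (.fst (.fst .id))
  unfold MLETeaching.subsets
  refine foldr
    (f := fun i b r => r.map (fun v => false :: v) ++ bif b && decide (r.length < k i) then
      (r.filter fun v => decide (MLETeaching.weight v < d i)).map fun v => true :: v else [])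
    (s := fun i => 1 + (2 * k i + 1) * (1 + (1 + (row i).length * (1 + 3))))
    (by fun_prop) (by fun_prop) hrow ?_ fun i l₁ l₂ hl => ?_
  · have h1 : PolyBdd k := (PolyBdd.of_PT hk).mono fun i => by rw [esize_nat]; omega
    exact (PolyBdd.const 1).add ((((PolyBdd.const 2).mul h1).add (.const 1)).mul
      ((PolyBdd.const 1).add ((PolyBdd.const 1).add ((PolyBdd.length hrow).mul (.const (1 + 3))))))
  · refine (esize_list_le fun v hv => ?_).trans
      (Nat.add_le_add_left (Nat.mul_le_mul_right _ (length_subsets_le (k i) (d i) l₂)) _)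
    refine (esize_list_le fun b _ => esize_bool_le b).trans
      (Nat.add_le_add_left (Nat.mul_le_mul_right _ ?_) _)
    rw [(subsets_sound hv).1.length_eq, ← hl, List.length_append]
    omega

@[fun_prop] theorem candidates {k d : ι → ℕ} {row : ι → List Bool} (hk : PT k) (hd : PT d)
    (hrow : PT row) : PT (fun i => candidates (k i) (d i) (row i)) := by
  unfold MLETeaching.candidates
  fun_prop

@[fun_prop] theorem bidders {d : ι → ℕ} {rows : ι → List (List Bool)} (hd : PT d)
    (hrows : PT rows) : PT (fun i => bidders (d i) (rows i)) := by
  unfold MLETeaching.bidders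
  fun_prop

@[fun_prop] theorem owned {A : ι → List Sale} {k : ι → ℕ} (hA : PT A) (hk : PT k) :
    PT (fun i => owned (A i) (k i)) := by
  have hk' : PT (fun x : ι × Sale × List Bool => k x.1) := hk.comp (.fst .id)
  refine foldr_of_max (f := fun i e r => bif decide (e.1.1 = k i) then e.2.1 else r)
    (by fun_prop) (const []) hA (PolyBdd.of_PT hA) fun i r e he => ?_
  have h1 := esize_le_of_mem he
  have h2 := esize_snd_lt e
  have h3 := esize_fst_lt e.2
  cases decide (e.1.1 = k i)
  · exact le_max_left ..
  · simp only [cond_true]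
    omega

@[fun_prop] theorem minMatching {m : ι → ℕ} {rows : ι → List (List Bool)} (hm : PT m)
    (hrows : PT rows) : PT (fun i => minMatching (m i) (rows i)) := by
  have hl : PT (fun i => List.range (m i + 1)) := by fun_prop
  have hg : PT (fun x : ι × ℕ => (true, x.2, (List.range (rows x.1).length).map
      (MLETeaching.owned (MLETeaching.auction (MLETeaching.bidders x.2 (rows x.1))).1))) := by
    fun_prop
  obtain ⟨s, hs, h⟩ := polyBdd_mem (f := fun i d => (true, d, (List.range (rows i).length).map
      (MLETeaching.owned (MLETeaching.auction (MLETeaching.bidders d (rows i))).1))) hl hg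
  refine foldr_of_max (f := fun i d r =>
    bif (MLETeaching.auction (MLETeaching.bidders d (rows i))).2.isEmpty then
      (true, d, (List.range (rows i).length).map
        (MLETeaching.owned (MLETeaching.auction (MLETeaching.bidders d (rows i))).1))
    else r) (b := fun _ => (false, 0, [])) (by fun_prop) (by fun_prop) hl hs fun i r a ha => ?_
  have h1 := h i a ha
  cases (MLETeaching.auction (MLETeaching.bidders a (rows i))).2.isEmpty
  · exact le_max_left ..
  · simp only [cond_true]
    omega

end PT
/-! ### Sampling without replacement -/

section sampling

variable {Z : Type*} {q : Z → ℝ} {A : Finset Z} {n : ℕ}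

/-- The probability that ordered sampling without replacement starts with the given sequence. -/
noncomputable def seqProb (q : Z → ℝ) (f : Fin n → Z) : ℝ :=
  ∏ i, q (f i) / (1 - ∑ j ∈ Finset.Iio i, q (f j))

open Classical in
theorem sampleProb_eq (q : Z → ℝ) (h : A.card = n) :
    sampleProb q A = ∑ σ : Fin n ≃ {z // z ∈ A}, seqProb q fun i => (σ i : Z) := by
  subst h
  rfl

theorem sum_comp_le [Fintype Z] (hq : ∀ z, 0 ≤ q z) {f : Fin n → Z} (hf : Function.Injective f)
    (s : Finset (Fin n)) : ∑ j ∈ s, q (f j) ≤ ∑ z, q z := by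
  classical
  rw [← Finset.sum_image (f := q) (g := f) fun x _ y _ h => hf h]
  exact Finset.sum_le_univ_sum_of_nonneg hq

theorem seqProb_nonneg [Fintype Z] (hq : ∀ z, 0 ≤ q z) (hq1 : ∑ z, q z = 1) {f : Fin n → Z}
    (hf : Function.Injective f) : 0 ≤ seqProb q f :=
  Finset.prod_nonneg fun _ _ => div_nonneg (hq _)
    (sub_nonneg.2 (hq1 ▸ sum_comp_le hq hf _))

theorem sampleProb_nonneg [Fintype Z] (hq : ∀ z, 0 ≤ q z) (hq1 : ∑ z, q z = 1)
    (A : Finset Z) : 0 ≤ sampleProb q A := by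
  classical
  rw [sampleProb_eq q rfl]
  exact Finset.sum_nonneg fun σ _ =>
    seqProb_nonneg hq hq1 (Subtype.val_injective.comp σ.injective)

theorem sampleProb_empty (q : Z → ℝ) : sampleProb q ∅ = 1 := by
  classical
  rw [sampleProb_eq q (n := 0) rfl]
  simp only [seqProb, Finset.univ_eq_empty, Finset.prod_empty, Finset.sum_const, nsmul_eq_mul,
    mul_one, Nat.cast_eq_one, Finset.card_univ]
  rw [Fintype.card_equiv (Equiv.equivOfIsEmpty _ _)]
  simp

theorem sampleProb_eq_zero {z : Z} (hz : z ∈ A) (h : q z = 0) : sampleProb q A = 0 := by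
  classical
  rw [sampleProb_eq q rfl]
  refine Finset.sum_eq_zero fun σ _ => Finset.prod_eq_zero (Finset.mem_univ (σ.symm ⟨z, hz⟩)) ?_
  simp [h]

/-- Replacing observations by more likely ones increases the probability of a sample. -/
theorem sampleProb_le_map [Fintype Z] (hq : ∀ z, 0 ≤ q z) (hq1 : ∑ z, q z = 1) (e : Z ↪ Z)
    (he : ∀ a ∈ A, q a ≤ q (e a)) : sampleProb q A ≤ sampleProb q (A.map e) := by
  classical
  rw [sampleProb_eq q rfl, sampleProb_eq q (Finset.card_map e),
    ← (Equiv.equivCongr (Equiv.refl _) (Finset.equivMap e A)).sum_comp]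
  refine Finset.sum_le_sum fun σ _ => Finset.prod_le_prod (fun i _ => div_nonneg (hq _)
    (sub_nonneg.2 (hq1 ▸ sum_comp_le (f := fun i => (σ i : Z)) hq
      (Subtype.val_injective.comp σ.injective) _))) fun i _ => ?_
  change q (σ i) / _ ≤ q (e (σ i)) / (1 - ∑ j ∈ Finset.Iio i, q (e (σ j)))
  have hinj : Function.Injective fun i => e (σ i) :=
    e.injective.comp (Subtype.val_injective.comp σ.injective)
  have h1 := sum_comp_le hq hinj (Finset.Iic i)
  rw [hq1, ← Finset.Iio_insert, Finset.sum_insert (by simp)] at h1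
  -- A denominator may vanish, but only where the numerator on the left is 0: if `q (σ i)` is
  -- positive, then the mass not yet drawn on the right is at least `q (e (σ i)) > 0`.
  rcases (hq (σ i)).eq_or_lt with h0 | h0
  · rw [← h0, zero_div]
    exact div_nonneg (hq _) (by linarith [hq (e (σ i))])
  · have h2 := he _ (σ i).2
    have h3 : ∑ j ∈ Finset.Iio i, q (σ j) ≤ ∑ j ∈ Finset.Iio i, q (e (σ j)) :=
      Finset.sum_le_sum fun j _ => he _ (σ j).2
    exact div_le_div₀ (hq _) h2 (by linarith) (by linarith)

theorem seqProb_snoc (q : Z → ℝ) (f : Fin n → Z) (z : Z) :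
    seqProb q (Fin.snoc f z : Fin (n + 1) → Z) = seqProb q f * (q z / (1 - ∑ j, q (f j))) := by
  rw [seqProb, Fin.prod_univ_castSucc]
  congr 1
  · refine Finset.prod_congr rfl fun i _ => ?_
    rw [Fin.snoc_castSucc (α := fun _ => Z), ← Fin.map_castSuccEmb_Iio, Finset.sum_map]
    simp
  · rw [Fin.snoc_last (α := fun _ => Z)]
    congr 2
    rw [Fin.Iio_last_eq_map, Finset.sum_map]
    simp

-- Induction on the length: given the first draws, the likelihoods of the remaining observations sum
-- to the remaining mass, so the last draw contributes a factor 1, or 0 when that mass is 0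
-- (division by zero). Hence an inequality.
open Classical in
theorem sum_seqProb_le [Fintype Z] (hq : ∀ z, 0 ≤ q z) (hq1 : ∑ z, q z = 1) (n : ℕ) :
    ∑ f : Fin n → Z with Function.Injective f, seqProb q f ≤ 1 := by
  induction n with
  | zero =>
    refine (Finset.sum_le_card_nsmul _ _ 1 fun f _ => by simp [seqProb]).trans ?_
    have := Finset.card_filter_le (Finset.univ : Finset (Fin 0 → Z)) Function.Injective
    simpa using this
  | succ n ih =>
    rw [Finset.sum_filter] at ih ⊢
    rw [← (Fin.snocEquiv fun _ : Fin (n + 1) => Z).sum_comp, Fintype.sum_prod_type_right]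
    refine le_trans (Finset.sum_le_sum fun f _ => ?_) ih
    split_ifs with hf
    · have h0 := seqProb_nonneg hq hq1 hf
      have h1 : 0 ≤ 1 - ∑ j, q (f j) := sub_nonneg.2 (hq1 ▸ sum_comp_le hq hf _)
      calc _ ≤ ∑ z, seqProb q f * (if z ∈ Set.range f then 0 else q z / (1 - ∑ j, q (f j))) := by
            refine Finset.sum_le_sum fun z _ => ?_
            change (if Function.Injective (Fin.snoc f z : Fin (n + 1) → Z) then
              seqProb q (Fin.snoc f z : Fin (n + 1) → Z) else 0) ≤ _
            rw [seqProb_snoc]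
            split_ifs with h2 h3 h3
            · exact absurd h3 (Fin.snoc_injective_iff.1 h2).2
            · exact le_rfl
            · simp
            · exact mul_nonneg h0 (div_nonneg (hq _) h1)
        _ = seqProb q f * ((1 - ∑ j, q (f j)) / (1 - ∑ j, q (f j))) := by
            rw [← Finset.mul_sum]
            congr 1
            have h2 : ∑ z, (if z ∈ Set.range f then q z else 0) = ∑ j, q (f j) := by
              rw [← Finset.sum_filter, ← Finset.sum_image (f := q) (g := f) fun x _ y _ h => hf h]
              refine Finset.sum_congr ?_ fun _ _ => rfl
              ext z; simp
            rw [← h2, ← hq1, ← Finset.sum_sub_distrib, Finset.sum_div]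
            refine Finset.sum_congr rfl fun z _ => ?_
            split_ifs <;> simp
        _ ≤ seqProb q f := mul_le_of_le_one_right h0 (div_self_le_one _)
    · refine (Finset.sum_eq_zero fun z _ => ?_).le
      refine if_neg fun h => hf (Fin.snoc_injective_iff.1 h).1

/-- Orderings of different sets are different injective sequences, so both probabilities are
disjoint parts of the sum in `sum_seqProb_le`. -/
theorem sampleProb_add_le [Fintype Z] (hq : ∀ z, 0 ≤ q z) (hq1 : ∑ z, q z = 1)
    {A B : Finset Z} (hAB : A ≠ B) (hcard : A.card = B.card) :
    sampleProb q A + sampleProb q B ≤ 1 := by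
  classical
  refine le_trans ?_ (sum_seqProb_le hq hq1 B.card)
  have key : ∀ D : Finset Z, D.card = B.card → sampleProb q D =
      ∑ f : Fin B.card → Z with Function.Injective f ∧ Set.range f = D, seqProb q f := by
    intro D hD
    rw [sampleProb_eq q hD]
    refine Finset.sum_bij (fun σ _ i => (σ i : Z)) (fun σ _ => ?_) (fun σ _ τ _ h => ?_)
      (fun f hf => ?_) fun _ _ => rfl
    · rw [Finset.mem_filter]
      refine ⟨Finset.mem_univ _, Subtype.val_injective.comp σ.injective, ?_⟩
      rw [show (fun i => (σ i : Z)) = Subtype.val ∘ σ from rfl, σ.surjective.range_comp]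
      simp
    · exact Equiv.ext fun i => Subtype.ext (congrFun h i)
    · obtain ⟨-, h1, h2⟩ := Finset.mem_filter.1 hf
      have h3 : ∀ i, f i ∈ D := fun i => by
        have : f i ∈ Set.range f := ⟨i, rfl⟩
        rwa [h2] at this
      refine ⟨Equiv.ofBijective (fun i => ⟨f i, h3 i⟩) ⟨fun i j h => h1 (congrArg Subtype.val h),
        fun ⟨z, hz⟩ => ?_⟩, Finset.mem_univ _, rfl⟩
      have hz' : z ∈ Set.range f := by rw [h2]; exact hz
      obtain ⟨i, rfl⟩ := hz'
      exact ⟨i, rfl⟩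
  rw [key A hcard, key B rfl, ← Finset.sum_union]
  · refine Finset.sum_le_sum_of_subset_of_nonneg (fun f hf => ?_) fun f hf _ =>
      seqProb_nonneg hq hq1 (Finset.mem_filter.1 hf).2
    rw [Finset.mem_union, Finset.mem_filter, Finset.mem_filter] at hf
    rw [Finset.mem_filter]
    tauto
  · refine Finset.disjoint_left.2 fun f h1 h2 => hAB ?_
    rw [Finset.mem_filter] at h1 h2
    exact Finset.coe_injective (h1.2.2.symm.trans h2.2.2)

/-- A heavy set is the most likely sample of its size. -/
theorem half_lt_sampleProb {m : ℕ} {W T : ℝ} (hA : A.card ≤ m) (hW : 2 * (m : ℝ) * m + 1 ≤ W)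
    (hT : A.card * W ≤ T) (hT' : T ≤ A.card * W + m) (hq : ∀ z ∈ A, q z = W / T) :
    1 / 2 < sampleProb q A := by
  classical
  obtain ⟨k, hk⟩ : ∃ k, A.card = k := ⟨_, rfl⟩
  rw [hk] at hT hT' hA
  have hm0 : (0 : ℝ) ≤ m := Nat.cast_nonneg m
  have hW0 : 0 < W := by nlinarith
  -- All elements of `A` have the same likelihood, so every ordering has the same probability.
  have hseq : ∀ σ : Fin k ≃ {z // z ∈ A}, seqProb q (fun i => (σ i : Z)) =
      ∏ i : Fin k, W / (T - i * W) := by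
    intro σ
    refine Finset.prod_congr rfl fun i _ => ?_
    have hk0 : (1 : ℝ) ≤ k := by exact_mod_cast (Nat.zero_le _).trans_lt i.2
    have hT0 : 0 < T := by nlinarith
    rw [hq _ (σ i).2, Finset.sum_congr rfl fun j _ => hq _ (σ j).2, Finset.sum_const, Fin.card_Iio,
      nsmul_eq_mul]
    rw [div_div, mul_sub, mul_one, ← mul_assoc, mul_comm T (i : ℝ), mul_assoc,
      mul_div_cancel₀ _ hT0.ne']
  have hcard : Fintype.card (Fin k ≃ {z // z ∈ A}) = k.factorial := by
    rw [Fintype.card_equiv (Fintype.equivOfCardEq (by simp [hk])), Fintype.card_fin]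
  -- The number of orderings is split over the draws: the `i`-th factor becomes the chance that this
  -- draw hits one of the `k - i` remaining elements of `A`.
  have hfac : (k.factorial : ℝ) = ∏ i : Fin k, ((k : ℝ) - i) := by
    rw [← Finset.prod_range_add_one_eq_factorial, ← Finset.prod_range_reflect, Nat.cast_prod,
      Fin.prod_univ_eq_prod_range (fun i => (k : ℝ) - i) k]
    refine Finset.prod_congr rfl fun i hi => ?_
    have := Finset.mem_range.1 hi
    rw [Nat.sub_sub, Nat.cast_add, Nat.cast_sub (by omega)]
    push_cast
    ring
  have hfactor : ∀ i : Fin k, 1 - m / W ≤ ((k : ℝ) - i) * (W / (T - i * W)) := by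
    intro i
    have hi : (i : ℝ) + 1 ≤ k := by exact_mod_cast i.2
    have h1 : 0 < T - i * W := by nlinarith
    rw [← mul_div_assoc, le_div_iff₀ h1]
    have h2 : (m / W) * W = m := div_mul_cancel₀ _ hW0.ne'
    have h3 : 0 ≤ m / W := div_nonneg hm0 hW0.le
    have h4 : W ≤ T - i * W := by nlinarith
    nlinarith
  have hmW : m / W ≤ 1 := by
    rw [div_le_one hW0]
    rcases Nat.eq_zero_or_pos m with rfl | hm
    · simpa using hW0.le
    · have : (1 : ℝ) ≤ m := by exact_mod_cast hm
      nlinarith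
  rw [sampleProb_eq q hk, Finset.sum_congr rfl fun σ _ => hseq σ, Finset.sum_const,
    Finset.card_univ, hcard, nsmul_eq_mul, hfac, ← Finset.prod_mul_distrib]
  -- Bernoulli's inequality; `W > 2m²` makes `k * (m / W)` less than 1/2.
  calc (1 / 2 : ℝ) < 1 + k * (-(m / W)) := by
        have h1 : (k : ℝ) ≤ m := by exact_mod_cast hA
        have h2 : (m : ℝ) * (m / W) < 1 / 2 := by
          rw [← mul_div_assoc, div_lt_iff₀ hW0]
          linarith
        have h3 : 0 ≤ m / W := div_nonneg hm0 hW0.le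
        nlinarith
    _ ≤ (1 + -(m / W)) ^ k := one_add_mul_le_pow (by linarith) k
    _ = ∏ _i : Fin k, (1 - m / W) := by
        rw [Finset.prod_const, Finset.card_univ, Fintype.card_fin, sub_eq_add_neg]
    _ ≤ _ := Finset.prod_le_prod (fun _ _ => by linarith) fun i _ => hfactor i

end sampling
/-! ### Matchings and teachers -/

/-- The empty sample has probability 1 under every concept, and an inconsistent one has probability
0 under its own concept; neither can be a strict maximum when a second concept exists. -/
theorem smn_le_mletd {C Z : Type*} [Fintype C] [Fintype Z] [Nontrivial C] (models : BipGraph C Z) :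
    smn models.plus sizeOfSet ≤ mletd models := by
  refine le_iInf fun L => le_iInf fun hL => le_iInf fun T => le_iInf fun hT => ?_
  have hlt : ∀ c c', c' ≠ c → sampleProb (L.lik c') (T c) < sampleProb (L.lik c) (T c) := by
    intro c c' hc
    have := (hT c).2 c' hc
    rw [hL c' c] at this
    exact lt_of_mul_lt_mul_left this (L.prior_pos c).le
  have hne : ∀ c, (T c).Nonempty := by
    intro c
    rw [Finset.nonempty_iff_ne_empty]
    intro h
    obtain ⟨c', hc⟩ := exists_ne c
    have := hlt c c' hc
    rw [h, sampleProb_empty, sampleProb_empty] at this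
    exact lt_irrefl _ this
  refine iInf₂_le_of_le (fun c => ⟨T c, hne c⟩) ⟨fun c c' h => ?_, fun c z hz => ?_⟩ le_rfl
  · by_contra hc
    have h1 := hlt c c' (Ne.symm hc)
    have h2 := hlt c' c hc
    rw [← Subtype.mk.inj h] at h2
    exact lt_asymm h1 h2
  · by_contra h
    obtain ⟨c', hc⟩ := exists_ne c
    have h1 := hlt c c' hc
    rw [sampleProb_eq_zero hz (L.valid c z h)] at h1
    exact h1.not_ge (sampleProb_nonneg (L.lik_nonneg c') (L.lik_sum c') _)

/-! ### The learner and the teacher obtained from a matching -/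

section learner

variable {C X : Type*} [Fintype X] {concept : C → Finset X}

open Classical in
/-- The labeled examples that are consistent with a concept. -/
noncomputable def consistent (concept : C → Finset X) (c : C) : Finset (X × Bool) :=
  Finset.univ.filter (labeled concept c)

theorem mem_consistent {c : C} {z : X × Bool} : z ∈ consistent concept c ↔ labeled concept c z := by
  simp [consistent]

/-- Each `x` has exactly one consistent label. The equal sizes turn inclusions between consistent
sets into equalities. -/
theorem card_consistent (c : C) : (consistent concept c).card = Fintype.card X := by
  classical
  refine Finset.card_bij' (fun z _ => z.1) (fun x _ => (x, decide (x ∈ concept c)))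
    (by simp) (fun x _ => mem_consistent.2 ?_) (fun z hz => ?_) (by simp)
  · simp only [labeled, decide_eq_true_eq, decide_eq_false_iff_not]
    tauto
  · obtain ⟨x, b⟩ := z
    have := mem_consistent.1 hz
    cases b <;> simpa [labeled] using this

theorem consistent_injective (h : Function.Injective concept) :
    Function.Injective (consistent concept) := by
  refine fun c c' hc => h (Finset.ext fun x => ?_)
  have h1 := Finset.ext_iff.1 hc (x, true)
  rw [mem_consistent, mem_consistent] at h1
  simpa [labeled] using h1

/-- The full set of consistent examples determines the concept; it is nonempty since an empty domain
has only one subset. -/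
theorem exists_isSaturatingMatching [Nontrivial C] (h : Function.Injective concept) :
    ∃ M, IsSaturatingMatching (labeled concept).plus M := by
  have hne : ∀ c, (consistent concept c).Nonempty := by
    intro c
    obtain ⟨c', hc⟩ := exists_ne c
    rw [← Finset.card_pos, card_consistent, Fintype.card_pos_iff]
    by_contra hX
    rw [not_nonempty_iff] at hX
    exact hc (h (Subsingleton.elim _ _))
  exact ⟨fun c => ⟨consistent concept c, hne c⟩,
    fun c c' hc => consistent_injective h (Subtype.mk.inj hc), fun c z hz => mem_consistent.1 hz⟩

open Classical in
/-- Unnormalized likelihoods: the examples matched with a concept are heavy, the other consistent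
examples are light. -/
noncomputable def matchWeight (concept : C → Finset X)
    (M : C → {B : Finset (X × Bool) // B.Nonempty}) (c : C) (z : X × Bool) : ℕ :=
  if z ∈ (M c).1 then 2 * Fintype.card X * Fintype.card X + 1
  else if labeled concept c z then 1 else 0

variable {M : C → {B : Finset (X × Bool) // B.Nonempty}}

theorem matchWeight_of_mem {c : C} {z : X × Bool} (h : z ∈ (M c).1) :
    matchWeight concept M c z = 2 * Fintype.card X * Fintype.card X + 1 := if_pos h

theorem matchWeight_pos {c : C} {z : X × Bool} (h : labeled concept c z) :
    0 < matchWeight concept M c z := by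
  rw [matchWeight, if_pos h]
  split_ifs <;> omega

theorem matchWeight_le {c : C} {z : X × Bool} (h : z ∉ (M c).1) :
    matchWeight concept M c z ≤ 1 := by
  rw [matchWeight, if_neg h]
  split_ifs <;> omega

theorem card_mul_le_sum_matchWeight (c : C) :
    (M c).1.card * (2 * Fintype.card X * Fintype.card X + 1) ≤
      ∑ z, matchWeight concept M c z := by
  rw [← smul_eq_mul, ← Finset.sum_const]
  exact (Finset.sum_le_sum fun z hz => (matchWeight_of_mem hz).ge).trans
    (Finset.sum_le_univ_sum_of_nonneg fun _ => Nat.zero_le _)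

theorem sum_matchWeight_le (c : C) : ∑ z, matchWeight concept M c z ≤
    (M c).1.card * (2 * Fintype.card X * Fintype.card X + 1) + Fintype.card X := by
  classical
  calc _ ≤ ∑ z, ((if z ∈ (M c).1 then 2 * Fintype.card X * Fintype.card X + 1 else 0) +
        if z ∈ consistent concept c then 1 else 0) := by
        refine Finset.sum_le_sum fun z _ => ?_
        simp only [matchWeight, mem_consistent]
        split_ifs <;> omega
    _ = _ := by
        rw [Finset.sum_add_distrib, Finset.sum_ite_mem, Finset.sum_ite_mem, Finset.univ_inter,
          Finset.univ_inter, Finset.sum_const, Finset.sum_const, card_consistent, smul_eq_mul,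
          smul_eq_mul, mul_one]

theorem sum_matchWeight_pos (c : C) : 0 < ∑ z, matchWeight concept M c z :=
  (Nat.mul_pos (M c).2.card_pos (Nat.succ_pos _)).trans_le (card_mul_le_sum_matchWeight c)

variable [Fintype C]

/-- The MLE-learner built from a saturating matching. -/
noncomputable def matchingLearner [Nonempty C]
    (hM : IsSaturatingMatching (labeled concept).plus M) : MAPLearner (labeled concept) where
  prior _ := ((1 : ℕ) : ℝ) / (Fintype.card C : ℕ)
  -- Written as a quotient of casts, so that the fractions of the representation agree with it
  -- definitionally.
  lik c z := (matchWeight concept M c z : ℝ) / ((∑ z, matchWeight concept M c z : ℕ) : ℝ)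
  prior_pos _ := by
    have := Fintype.card_pos (α := C)
    positivity
  prior_sum := by simp
  lik_nonneg _ _ := by positivity
  lik_sum c := by
    rw [← Finset.sum_div, ← Nat.cast_sum, div_self]
    exact_mod_cast (sum_matchWeight_pos c).ne'
  valid c z h := by
    have h1 : z ∉ (M c).1 := fun hz => h (hM.2 c z hz)
    simp [matchWeight, h, h1]

theorem isMLE_matchingLearner [Nonempty C]
    (hM : IsSaturatingMatching (labeled concept).plus M) : (matchingLearner hM).IsMLE :=
  fun _ _ => rfl

theorem lik_le_lik_iff [Nonempty C] (hM : IsSaturatingMatching (labeled concept).plus M) {c : C}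
    {z z' : X × Bool} (h : matchWeight concept M c z ≤ matchWeight concept M c z') :
    (matchingLearner hM).lik c z ≤ (matchingLearner hM).lik c z' :=
  div_le_div_of_nonneg_right (by exact_mod_cast h) (Nat.cast_nonneg _)

/-- This is one purpose of the light examples: they give every concept `|X|` observations of
positive likelihood, so no matched set exceeds the permitted sample size. -/
theorem minPos_matchingLearner [Nonempty C]
    (hM : IsSaturatingMatching (labeled concept).plus M) :
    (matchingLearner hM).minPos = Fintype.card X := by
  have h : ∀ c, (matchingLearner hM).posObs c = consistent concept c := by
    intro c
    ext z
    rw [mem_consistent, MAPLearner.posObs, Finset.mem_filter]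
    refine ⟨fun h => ?_, fun h => ⟨Finset.mem_univ _, ?_⟩⟩
    · by_contra hz
      exact h.2.ne' ((matchingLearner hM).valid c z hz)
    · exact div_pos (by exact_mod_cast matchWeight_pos h)
        (by exact_mod_cast sum_matchWeight_pos c)
  simp only [MAPLearner.minPos, h, card_consistent]
  exact ciInf_const

theorem isTeacher_matchingLearner [Nonempty C] (hC : Function.Injective concept)
    (hM : IsSaturatingMatching (labeled concept).plus M) :
    (matchingLearner hM).IsTeacher fun c => (M c).1 := by
  classical
  intro c₀
  have hsub : ∀ c, (M c).1 ⊆ consistent concept c := fun c z hz => mem_consistent.2 (hM.2 c z hz)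
  have hcard : ∀ c, (M c).1.card ≤ Fintype.card X := fun c =>
    card_consistent (concept := concept) c ▸ Finset.card_le_card (hsub c)
  refine ⟨(hcard c₀).trans (minPos_matchingLearner hM).ge, fun c hc => ?_⟩
  refine mul_lt_mul_of_pos_left ?_ ((matchingLearner hM).prior_pos c₀)
  have hhigh : 1 / 2 < sampleProb ((matchingLearner hM).lik c₀) (M c₀).1 := by
    refine half_lt_sampleProb (m := Fintype.card X)
      (W := ((2 * Fintype.card X * Fintype.card X + 1 : ℕ) : ℝ))
      (T := ((∑ z, matchWeight concept M c₀ z : ℕ) : ℝ)) (hcard c₀) (by push_cast; exact le_rfl)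
      (by exact_mod_cast card_mul_le_sum_matchWeight c₀) (by exact_mod_cast sum_matchWeight_le c₀)
      fun z hz => ?_
    change (matchWeight concept M c₀ z : ℝ) / _ = _
    rw [matchWeight_of_mem hz]
  refine lt_of_le_of_lt ?_ hhigh
  by_cases hA : (M c₀).1 ⊆ consistent concept c
  · have hne : (M c₀).1 ≠ consistent concept c := fun h => by
      have h1 := Finset.eq_of_subset_of_card_le (hsub c₀)
        (by rw [h, card_consistent, card_consistent])
      exact hc (consistent_injective hC (h.symm.trans h1))
    -- The exchange pair. If `M c₀ ⊆ M c`, the inclusion is proper and both elements are heavy for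
    -- `c`; otherwise a light element of `M c₀` is exchanged for a consistent one outside.
    obtain ⟨z, hz, z', hz', hle⟩ : ∃ z ∈ (M c₀).1, ∃ z' ∉ (M c₀).1,
        matchWeight concept M c z ≤ matchWeight concept M c z' := by
      by_cases hAM : (M c₀).1 ⊆ (M c).1
      · obtain ⟨z, hz⟩ := (M c₀).2
        obtain ⟨z', hz', h'⟩ := Finset.exists_of_ssubset
          (hAM.ssubset_of_ne fun h => hc (hM.1 (Subtype.ext h)).symm)
        exact ⟨z, hz, z', h', by rw [matchWeight_of_mem (hAM hz), matchWeight_of_mem hz']⟩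
      · obtain ⟨z, hz, hzM⟩ := Finset.not_subset.1 hAM
        obtain ⟨z', hz', h'⟩ := Finset.exists_of_ssubset (hA.ssubset_of_ne hne)
        exact ⟨z, hz, z', h', (matchWeight_le hzM).trans (matchWeight_pos (mem_consistent.1 hz'))⟩
    have h1 := sampleProb_le_map (A := (M c₀).1) ((matchingLearner hM).lik_nonneg c)
      ((matchingLearner hM).lik_sum c) (Equiv.swap z z').toEmbedding fun a ha => by
        rw [Equiv.toEmbedding_apply]
        by_cases haz : a = z
        · rw [haz, Equiv.swap_apply_left]
          exact lik_le_lik_iff hM hle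
        · rw [Equiv.swap_apply_of_ne_of_ne haz fun h' => hz' (by rwa [h'] at ha)]
    have h2 := sampleProb_add_le ((matchingLearner hM).lik_nonneg c)
      ((matchingLearner hM).lik_sum c) (A := (M c₀).1)
      (B := (M c₀).1.map (Equiv.swap z z').toEmbedding) (fun h => hz' ?_) (by simp)
    · linarith
    · rw [h]
      exact Finset.mem_map.2 ⟨z, hz, by simp⟩
  · obtain ⟨z, hz, hzc⟩ := Finset.not_subset.1 hA
    rw [mem_consistent] at hzc
    rw [sampleProb_eq_zero hz ((matchingLearner hM).valid c z hzc)]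
    norm_num

theorem smn_eq_mletd [Nontrivial C] (hC : Function.Injective concept) :
    smn (labeled concept).plus sizeOfSet = mletd (labeled concept) :=
  (smn_le_mletd _).antisymm <| le_iInf₂ fun M hM =>
    iInf₂_le_of_le (matchingLearner hM) (isMLE_matchingLearner hM)
      (iInf₂_le_of_le (fun c => (M c).1) (isTeacher_matchingLearner hC hM) le_rfl)

end learner

theorem IsMinSaturatingMatching.order_eq_smn {V₁ V₂ : Type*} [Fintype V₁] {G : BipGraph V₁ V₂}
    {size : V₂ → ℕ} {M : V₁ → V₂} (hM : IsMinSaturatingMatching G size M) :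
    (order size M : ℕ∞) = smn G size :=
  le_antisymm (le_iInf₂ fun M' hM' => by exact_mod_cast hM.2 M' hM') (iInf₂_le M hM.1)

/-! ### The computational problems -/

section encodings

variable {n : ℕ} {V : Type*}

theorem enc_decide (P : Prop) [Decidable P] : enc (decide P) = Data.ofProp P := by
  by_cases h : P <;> simp [Data.ofProp, h] <;> rfl

theorem ofTable_eq {α β γ : Type*} [Enc γ] (r : List α) (s : List β) (f : α → β → γ) :
    Data.ofTable r s (fun a b => enc (f a b)) = enc (r.map fun a => s.map (f a)) := by
  simp only [Data.ofTable, enc, List.map_map, Function.comp_def]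

theorem ofRel_eq (s : List V) (R : Fin n → V → Prop) :
    Data.ofRel (List.finRange n) s R = enc (s.length, adjRows R s) := by
  classical
  simp only [Data.ofRel, ← enc_decide, ofTable_eq]
  rfl

theorem esize_adjRows_le (s : List V) (R : Fin n → V → Prop) :
    esize (adjRows R s) ≤ 1 + n * (1 + (1 + s.length * (1 + 3))) := by
  refine (esize_list_le (k := 1 + s.length * (1 + 3)) fun v hv => ?_).trans_eq (by simp)
  obtain ⟨i, -, rfl⟩ := List.mem_map.1 hv
  exact (esize_list_le fun b _ => esize_bool_le b).trans_eq (by simp [charVec])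

/-- The first two summands bound the unary column count and the overhead, the last one the matrix;
`n` and `m` are both replaced by `n + m`. -/
theorem esize_matrix_le (m : ℕ) (R : Fin n → Fin m → Prop) :
    esize ((List.finRange m).length, adjRows R (List.finRange m)) ≤
      (3 + 2 * Polynomial.X + Polynomial.X * (2 + 4 * Polynomial.X) : Polynomial ℕ).eval
        (n + m) := by
  have := esize_adjRows_le (List.finRange m) R
  rw [esize_pair, esize_nat]
  simp only [Polynomial.eval_add, Polynomial.eval_mul, Polynomial.eval_X, Polynomial.eval_ofNat]
  rw [List.length_finRange] at *
  nlinarith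

end encodings

/-- Trees present themselves, so nothing changes. Viewing outputs as trees allows a branch between a
matrix and the error message. -/
theorem PT.toData {α β : Type*} [Enc α] [Enc β] {f : α → β} (hf : PT f) :
    PT (fun a => enc (f a)) := hf

theorem polyTimeSolvable_matching :
    PolyTimeSolvable GraphInstance.param GraphInstance.encode
      (fun I y =>
        (∃ M, IsMinSaturatingMatching I.graph.plus sizeOfSet M ∧ y = I.encodeMap M) ∨
        ((¬ ∃ M, IsSaturatingMatching I.graph.plus M) ∧ y = Data.nil)) := by
  have h1 : PT (fun x : ℕ × List (List Bool) => enc (x.1, (minMatching x.1 x.2).2.2)) :=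
    PT.toData (by fun_prop)
  have h2 : PT (fun x : ℕ × List (List Bool) => bif (minMatching x.1 x.2).1 then
    enc (x.1, (minMatching x.1 x.2).2.2) else Data.nil) := by fun_prop
  refine h2.polyTimeSolvable
    (fun I => ((List.finRange I.m).length, adjRows I.graph (List.finRange I.m)))
    (fun I => (ofRel_eq _ _).symm) _ (fun I => esize_matrix_le I.m I.graph) fun I => ?_
  dsimp only
  rcases minMatching_spec (G := I.graph) (List.nodup_finRange I.m) List.mem_finRange with
    ⟨M, hM, h⟩ | ⟨h, h'⟩
  · refine Or.inl ⟨M, hM, ?_⟩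
    rw [h]
    exact (ofRel_eq _ _).symm
  · refine Or.inr ⟨h, ?_⟩
    rw [h']
    rfl

/-! #### Concept classes -/

/-- The adjacency matrix of the consistency graph, from the membership matrix. -/
def consistencyRows (rows : List (List Bool)) : List (List Bool) :=
  rows.map fun r => r.flatMap fun b => [!b, b]

/-- The optimal matching in the consistency graph. -/
def classMatching (x : ℕ × List (List Bool)) : Bool × ℕ × List (List Bool) :=
  minMatching (x.1 + x.1) (consistencyRows x.2)

/-- The unnormalized likelihoods of a concept, from the rows of the consistency graph and of
the matching. -/
def weights (W : ℕ) (r s : List Bool) : List ℕ :=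
  (r.zip s).map fun y => bif y.2 then W else bif y.1 then 1 else 0

/-- The fractions that represent the learner. -/
def learnerTable (x : ℕ × List (List Bool)) : List (ℕ × ℕ) × List (List (ℕ × ℕ)) :=
  (x.2.map fun _ => (1, x.2.length),
    ((consistencyRows x.2).zip (classMatching x).2.2).map fun y =>
      (weights (2 * x.1 * x.1 + 1) y.1 y.2).map fun w =>
        (w, (weights (2 * x.1 * x.1 + 1) y.1 y.2).sum))

/-! ### Running time for concept classes -/

namespace PT

variable {ι : Type*} [Enc ι]

@[fun_prop] theorem sum {l : ι → List ℕ} (hl : PT l) : PT (fun i => (l i).sum) := by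
  refine foldr_of_add (f := fun _ a r => a + r) (by fun_prop) (const 0) hl (PolyBdd.of_PT hl)
    fun i r a ha => ?_
  have := esize_le_of_mem ha
  simp only [esize_nat] at *
  omega

@[fun_prop] theorem consistencyRows {rows : ι → List (List Bool)} (h : PT rows) :
    PT (fun i => consistencyRows (rows i)) := by
  unfold MLETeaching.consistencyRows
  fun_prop

@[fun_prop] theorem classMatching {x : ι → ℕ × List (List Bool)} (h : PT x) :
    PT (fun i => classMatching (x i)) := by
  unfold MLETeaching.classMatching
  fun_prop

@[fun_prop] theorem weights {W : ι → ℕ} {r s : ι → List Bool} (hW : PT W) (hr : PT r)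
    (hs : PT s) : PT (fun i => weights (W i) (r i) (s i)) := by
  unfold MLETeaching.weights
  fun_prop

theorem learnerTable : PT learnerTable := by
  unfold MLETeaching.learnerTable
  fun_prop

end PT

/-! ### Correctness for concept classes -/

namespace ClassInstance

variable (I : ClassInstance)

instance : Nontrivial (Fin I.n) := Fin.nontrivial_iff_two_le.2 I.two_le

/-- The membership matrix. -/
noncomputable def matrix : ℕ × List (List Bool) :=
  ((List.finRange I.m).length, adjRows (fun c x => x ∈ I.concept c) (List.finRange I.m))

theorem nodup_obsList : I.obsList.Nodup := by
  refine List.nodup_flatMap.2 ⟨fun x _ => by simp, (List.nodup_finRange I.m).imp fun {x y} h => ?_⟩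
  simp [Function.onFun, Ne.symm h]

theorem mem_obsList (z : I.Obs) : z ∈ I.obsList := by
  obtain ⟨x, b⟩ := z
  refine List.mem_flatMap.2 ⟨x, List.mem_finRange x, ?_⟩
  cases b <;> simp

theorem length_obsList : I.obsList.length = I.m + I.m := by
  simp [obsList, List.length_flatMap, Nat.mul_two]

/-- The order of `[!b, b]` matches `obsList`, where the negative example of each `x` precedes the
positive one. -/
theorem consistencyRows_matrix :
    consistencyRows I.matrix.2 = adjRows I.models I.obsList := by
  classical
  simp only [consistencyRows, matrix, adjRows, List.map_map]
  refine List.map_congr_left fun c _ => ?_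
  simp only [Function.comp_apply, charVec, obsList, List.map_flatMap, List.flatMap_map]
  congr 1
  funext x
  simp [models, labeled]

theorem classMatching_matrix : ∃ M : Fin I.n → {B : Finset I.Obs // B.Nonempty},
    IsMinSaturatingMatching I.models.plus sizeOfSet M ∧
      classMatching I.matrix = (true, order sizeOfSet M,
        adjRows (fun c z => z ∈ (M c).1) I.obsList) := by
  have h1 : classMatching I.matrix = minMatching I.obsList.length (adjRows I.models I.obsList) := by
    rw [classMatching, consistencyRows_matrix, length_obsList, matrix, List.length_finRange]
  rw [h1]
  rcases minMatching_spec (G := I.models) I.nodup_obsList I.mem_obsList with ⟨M, hM, h⟩ | ⟨h, -⟩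
  · exact ⟨M, hM, h⟩
  · exact absurd (exists_isSaturatingMatching I.injective) h

theorem learnerTable_matrix {M : Fin I.n → {B : Finset I.Obs // B.Nonempty}}
    (h : (classMatching I.matrix).2.2 = adjRows (fun c z => z ∈ (M c).1) I.obsList) :
    learnerTable I.matrix = ((List.finRange I.n).map fun _ => (1, I.n),
      (List.finRange I.n).map fun c => I.obsList.map fun z =>
        (matchWeight I.concept M c z, ∑ z, matchWeight I.concept M c z)) := by
  classical
  have hw : ∀ c, weights (2 * I.matrix.1 * I.matrix.1 + 1) (charVec I.obsList (I.models c))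
      (charVec I.obsList fun z => z ∈ (M c).1) = I.obsList.map (matchWeight I.concept M c) := by
    intro c
    simp only [weights, charVec, List.zip_map', List.map_map]
    refine List.map_congr_left fun z _ => ?_
    simp [matchWeight, matrix, Bool.cond_eq_ite]
  have hsum : ∀ c, (I.obsList.map (matchWeight I.concept M c)).sum =
      ∑ z, matchWeight I.concept M c z := by
    intro c
    rw [← List.sum_toFinset _ I.nodup_obsList]
    refine Finset.sum_congr (Finset.eq_univ_iff_forall.2 fun z => ?_) fun _ _ => rfl
    exact List.mem_toFinset.2 (I.mem_obsList z)
  rw [learnerTable, h, consistencyRows_matrix]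
  refine Prod.ext ?_ ?_
  · simp only [matrix, adjRows, List.map_map, List.length_map, List.length_finRange]
    rfl
  · simp only [adjRows, List.zip_map', List.map_map]
    refine List.map_congr_left fun c _ => ?_
    simp only [Function.comp_apply, hw, hsum, List.map_map]
    rfl

theorem polyTimeSolvable {β : Type*} [Enc β] {F : ℕ × List (List Bool) → β} (hF : PT F)
    {IsSolution : ClassInstance → Data → Prop}
    (h : ∀ I : ClassInstance, IsSolution I (enc (F I.matrix))) :
    PolyTimeSolvable ClassInstance.param ClassInstance.encode IsSolution :=
  hF.polyTimeSolvable matrix (fun _ => (ofRel_eq _ _).symm) _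
    (fun I => esize_matrix_le I.m fun c x => x ∈ I.concept c) h

theorem enc_eq_encodeRel (R : Fin I.n → I.Obs → Prop) :
    enc (I.matrix.1 + I.matrix.1, adjRows R I.obsList) = I.encodeRel R := by
  rw [encodeRel, ofRel_eq, length_obsList, matrix, List.length_finRange]

theorem polyTimeSolvable_consistency :
    PolyTimeSolvable ClassInstance.param ClassInstance.encode
      (fun I y => y = I.encodeRel I.models) := by
  refine polyTimeSolvable (F := fun x => (x.1 + x.1, consistencyRows x.2)) (by fun_prop)
    fun I => ?_
  rw [consistencyRows_matrix, enc_eq_encodeRel]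

theorem polyTimeSolvable_parameters :
    PolyTimeSolvable ClassInstance.param ClassInstance.encode
      (fun I y => ∃ d : ℕ, smn I.models.plus sizeOfSet = d ∧ mletd I.models = d ∧
        y = Data.ofNat d) := by
  refine polyTimeSolvable (F := fun x => (classMatching x).2.1) (by fun_prop) fun I => ?_
  obtain ⟨M, hM, h⟩ := I.classMatching_matrix
  refine ⟨_, hM.order_eq_smn.symm, ?_, by rw [h]; rfl⟩
  rw [hM.order_eq_smn]
  exact (smn_eq_mletd I.injective).symm

theorem polyTimeSolvable_matching :
    PolyTimeSolvable ClassInstance.param ClassInstance.encode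
      (fun I y => ∃ M, IsSaturatingMatching I.models.plus M ∧
        (order sizeOfSet M : ℕ∞) = smn I.models.plus sizeOfSet ∧
        y = I.encodeMap fun c => (M c).1) := by
  refine polyTimeSolvable (F := fun x => (x.1 + x.1, (classMatching x).2.2)) (by fun_prop)
    fun I => ?_
  obtain ⟨M, hM, h⟩ := I.classMatching_matrix
  refine ⟨M, hM.1, hM.order_eq_smn, ?_⟩
  rw [h, enc_eq_encodeRel]
  rfl

theorem polyTimeSolvable_learner :
    PolyTimeSolvable ClassInstance.param ClassInstance.encode
      (fun I y => ∃ (L : MAPLearner I.models) (T : Fin I.n → Finset I.Obs) (yL : Data),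
        L.IsMLE ∧ L.IsTeacher T ∧ (order Finset.card T : ℕ∞) = mletd I.models ∧
        I.RepresentsLearner L yL ∧ y = Data.cons yL (I.encodeMap T)) := by
  refine polyTimeSolvable
    (F := fun x => (learnerTable x, (x.1 + x.1, (classMatching x).2.2)))
    (PT.learnerTable.pair (by fun_prop)) fun I => ?_
  obtain ⟨M, hM, h⟩ := I.classMatching_matrix
  refine ⟨matchingLearner hM.1, fun c => (M c).1, enc (learnerTable I.matrix),
    isMLE_matchingLearner hM.1, isTeacher_matchingLearner I.injective hM.1,
    hM.order_eq_smn.trans (smn_eq_mletd I.injective), ?_, ?_⟩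
  · refine ⟨fun _ => 1, fun _ => I.n, matchWeight I.concept M,
      fun c _ => ∑ z, matchWeight I.concept M c z,
      fun c => ⟨Nat.zero_lt_of_lt I.two_le, ?_⟩, fun c z => ⟨sum_matchWeight_pos c, rfl⟩, ?_⟩
    · change ((1 : ℕ) : ℝ) / (Fintype.card (Fin I.n) : ℕ) = _
      rw [Fintype.card_fin]
    · rw [learnerTable_matrix I (M := M) (by rw [h])]
      change Data.cons _ _ = _
      congr 1
      · simp only [enc, List.map_map]
        rfl
      · rw [← ofTable_eq]
        rfl
  · change Data.cons _ (enc (I.matrix.1 + I.matrix.1, (classMatching I.matrix).2.2)) = _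
    rw [h, enc_eq_encodeRel]
    rfl

end ClassInstance
end MLETeaching

open MLETeaching
theorem mainTheorem7 :
    -- a minimum-order saturating matching in `G⁺`, or the error message `nil`
    PolyTimeSolvable GraphInstance.param GraphInstance.encode
      (fun I y =>
        (∃ M, IsMinSaturatingMatching I.graph.plus sizeOfSet M ∧ y = I.encodeMap M) ∨
        ((¬ ∃ M, IsSaturatingMatching I.graph.plus M) ∧ y = Data.nil)) ∧
    -- the two parameters are identical
    (∀ (C X : Type*) [Fintype C] [Fintype X] [Nontrivial C] (concept : C → Finset X),
      Function.Injective concept →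
        smn (labeled concept).plus sizeOfSet = mletd (labeled concept)) ∧
    -- the consistency graph
    PolyTimeSolvable ClassInstance.param ClassInstance.encode
      (fun I y => y = I.encodeRel I.models) ∧
    -- the two parameters
    PolyTimeSolvable ClassInstance.param ClassInstance.encode
      (fun I y => ∃ d : ℕ, smn I.models.plus sizeOfSet = d ∧ mletd I.models = d ∧
        y = Data.ofNat d) ∧
    -- a saturating matching of optimal order
    PolyTimeSolvable ClassInstance.param ClassInstance.encode
      (fun I y => ∃ M, IsSaturatingMatching I.models.plus M ∧
        (order sizeOfSet M : ℕ∞) = smn I.models.plus sizeOfSet ∧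
        y = I.encodeMap fun c => (M c).1) ∧
    -- an MLE-learner together with a teacher of optimal order for it
    PolyTimeSolvable ClassInstance.param ClassInstance.encode
      (fun I y => ∃ (L : MAPLearner I.models) (T : Fin I.n → Finset I.Obs) (yL : Data),
        L.IsMLE ∧ L.IsTeacher T ∧ (order Finset.card T : ℕ∞) = mletd I.models ∧
        I.RepresentsLearner L yL ∧ y = Data.cons yL (I.encodeMap T)) := by
  exact ⟨polyTimeSolvable_matching, fun C X _ _ _ concept h => smn_eq_mletd h,
    ClassInstance.polyTimeSolvable_consistency, ClassInstance.polyTimeSolvable_parameters,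
    ClassInstance.polyTimeSolvable_matching, ClassInstance.polyTimeSolvable_learner⟩
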